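/- Fix $\beta>0$ and let $M_\beta(z)=\frac{z-i\beta}{z+i\beta}$, $T(\theta)=M_\beta^{-1}(e^{i\theta})$ for $0<\theta<2\pi$. For a continuous $f:\mathbb R\to\mathbb C$ in $H^1(\mathbb R)$ let $F$ be the $2\pi$-periodic function $F(\theta)=f(T(\theta))$ for $\theta\notin 2\pi\mathbb Z$, $F(\theta)=0$ for $\theta\in 2\pi\mathbb Z$ (the value of $f$ at infinity). For $n\ge 1$ put $\theta_l=2\pi l/n$, $\tilde F_j=\frac1n\sum_{l=0}^{n-1}e^{-ij\theta_l}F(\theta_l)$, and let $$\mathcal R_nf(x)=\sum_{j=-\lfloor (n-1)/2\rfloor}^{\lfloor n/2\rfloor}\tilde F_j\,M_\beta(x)^j$$ be the rational interpolant of $f$. Use the norms $$\|F\|_{H^s(\mathbb T)}^2=\sum_{j\in\mathbb Z}(1+|j|)^{2s}|\hat F_j|^2,\qquad \|f\|_{H^s(\mathbb R)}^2=\int_{\mathbb R}(1+|\xi|)^{2s}|\mathcal Ff(\xi)|^2\,d\xi,$$ where $\hat F_j=\frac1{2\pi}\int_0^{2\pi}e^{-ij\theta}F(\theta)\,d\theta$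 and $\mathcal Ff(\xi)=\int_{\mathbb R}e^{-i\xi x}f(x)\,dx$ (extended to $L^2$), and the usual norm on $L^2(\mathbb R)$. For $k\in\mathbb R$ and $z\in\mathbb C\setminus\mathbb R$ let $$\mathcal C_{\mathbb R,k}f(z)=\frac1{2\pi i}\int_{\mathbb R}\frac{e^{-ikx}f(x)}{x-z}\,dx,\qquad \mathcal C_{\mathbb R,k,n}f=\mathcal C_{\mathbb R,k}\mathcal R_nf,$$ with boundary values $\mathcal C^{\pm}f(x)=\lim_{\eta\to0^+}\mathcal Cf(x\pm i\eta)$. For $\delta>0$ and a choice of sign let $E^{\pm}_{n,\delta}(x)=(\mathcal C_{\mathbb R,k}-\mathcal C_{\mathbb R,k,n})f(x\pm i\delta)$, and let $E^\pm_{n,0}=\mathcal C^\pm_{\mathbb R,k}f-\mathcal C^\pm_{\mathbb R,k,n}f$ be the difference of the boundary values. The norm of the error in $H^1(\mathbb R\pm i\delta)$ or $L^2(\mathbb R\pm i\delta)$ is the norm of $E^\pm_{n,\delta}$ in $H^1(\mathbb R)$ or $L^2(\mathbb R)$. **Theorem.** Let $\epsilon>0$ and $s>1+\epsilon$. There is a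 constant $C>0$, depending only on $\epsilon$, $s$ and $\beta$, such that for every continuous $f\in H^1(\mathbb R)$ with $F\in H^s(\mathbb T)$ and every $k\in\mathbb R$: the Cauchy integrals of $e^{-ikx}f$ and of $e^{-ikx}\mathcal R_nf$ ($n\ge1$) converge absolutely for $z\notin\mathbb R$ and their boundary values exist at every $x\in\mathbb R$; for all $n\ge1$, all $\delta\ge0$ and both signs, $$\|E^\pm_{n,\delta}\|_{H^1(\mathbb R)}\le(1+|k|)\,\|\mathcal R_nf-f\|_{H^1(\mathbb R)}\le C(1+|k|)\,n^{1+\epsilon-s}\|F\|_{H^s(\mathbb T)},$$ $$\|E^\pm_{n,\delta}\|_{L^2(\mathbb R)}\le\|\mathcal R_nf-f\|_{L^2(\mathbb R)}\le C\,n^{1+\epsilon-s}\|F\|_{H^s(\mathbb T)},$$ $$\sup_{x\in\mathbb R}|E^\pm_{n,\delta}(x)|\le\|E^\pm_{n,0}\|_{H^1(\mathbb R)},\qquad \sup_{x\in\mathbb R}|E^\pm_{n,\delta}(x)|\le C(1+|k|)\,n^{1+\epsilon-s}\|F\|_{H^s(\mathbb T)}.$$ Consequently, for fixed $k$, as $n\to\infty$,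 $\mathcal C_{\mathbb R,k,n}f\to\mathcal C_{\mathbb R,k}f$ uniformly on $\mathbb C\setminus\mathbb R$ and $\mathcal C^\pm_{\mathbb R,k,n}f\to\mathcal C^\pm_{\mathbb R,k}f$ uniformly on $\mathbb R$. -/

import Mathlib

noncomputable section

open MeasureTheory Filter Topology Complex FourierTransform
open scoped ENNReal

namespace OscCauchy

/-! ### Periodic Sobolev spaces -/

/-- The Fourier coefficient `(1 / 2π) ∫₀^{2π} e^{-ijθ} F(θ) dθ`. -/
def periodicCoeff (F : ℝ → ℂ) (j : ℤ) : ℂ :=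
  fourierCoeffOn Real.two_pi_pos F j

/-- The norm `(∑_j (1 + |j|)^{2s} |F̂_j|²)^{1/2}` of `H^s(𝕋)`, with values in `[0, ∞]`. -/
def periodicSobolevNorm (s : ℝ) (F : ℝ → ℂ) : ℝ≥0∞ :=
  (∑' j : ℤ, ENNReal.ofReal ((1 + |(j : ℝ)|) ^ (2 * s) * ‖periodicCoeff F j‖ ^ 2)) ^ (1 / 2 : ℝ)

/-- Membership of `F`, restricted to one period `[0, 2π]`, in `H^s(𝕋)`. -/
def MemPeriodicSobolev (s : ℝ) (F : ℝ → ℂ) : Prop :=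
  MemLp F 2 (volume.restrict (Set.Ioc 0 (2 * Real.pi))) ∧ periodicSobolevNorm s F < ∞

/-! ### Sobolev spaces on the line -/

/-- The `L²` Fourier transform in the normalization `𝓕 f(ξ) = ∫ e^{-iξx} f(x) dx`
(Mathlib's transform has the kernel `e^{-2πiξx}`). -/
def lineFourier (f : ℝ → ℂ) (hf : MemLp f 2 volume) (ξ : ℝ) : ℂ :=
  (𝓕 (hf.toLp f) : Lp ℂ 2 (volume : Measure ℝ)) (ξ / (2 * Real.pi))

open Classical in
/-- The norm `(∫ (1 + |ξ|)^{2s} |𝓕 f(ξ)|² dξ)^{1/2}` of `H^s(ℝ)`, with values in `[0, ∞]`;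
it is `∞` if `f` is not in `L²(ℝ)`. -/
def sobolevNorm (s : ℝ) (f : ℝ → ℂ) : ℝ≥0∞ :=
  if hf : MemLp f 2 volume then
    (∫⁻ ξ : ℝ, ENNReal.ofReal ((1 + |ξ|) ^ (2 * s) * ‖lineFourier f hf ξ‖ ^ 2)) ^ (1 / 2 : ℝ)
  else ∞

/-- Membership in `H^s(ℝ)`. -/
def MemSobolevLine (s : ℝ) (f : ℝ → ℂ) : Prop :=
  MemLp f 2 volume ∧ sobolevNorm s f < ∞

/-! ### Rational interpolation on the line -/

/-- The Möbius transformation `M_β(z) = (z - iβ) / (z + iβ)`. -/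
def moebius (β : ℝ) (z : ℂ) : ℂ := (z - I * β) / (z + I * β)

/-- The inverse Möbius transformation `M_β⁻¹(z) = (β / i) (z + 1) / (z - 1)`. -/
def moebiusInv (β : ℝ) (z : ℂ) : ℂ := β / I * ((z + 1) / (z - 1))

/-- `M_β⁻¹` is real-valued on the unit circle. -/
theorem moebiusInv_exp_im (β θ : ℝ) : (moebiusInv β (exp (θ * I))).im = 0 := by
  rw [← Complex.conj_eq_iff_im]
  have h : (starRingEnd ℂ) (exp (θ * I)) = (exp (θ * I))⁻¹ := by
    rw [← Complex.exp_conj, ← Complex.exp_neg]; simp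
  have hz : exp (θ * I) ≠ 0 := Complex.exp_ne_zero _
  unfold moebiusInv
  simp only [map_mul, map_div₀, map_add, map_sub, map_one, Complex.conj_ofReal, Complex.conj_I, h]
  generalize exp (θ * I) = z at *
  by_cases h1 : z = 1
  · subst h1; simp
  · have h2 : z - 1 ≠ 0 := sub_ne_zero.mpr h1
    have h3 : (1 : ℂ) - z ≠ 0 := sub_ne_zero.mpr (Ne.symm h1)
    have h4 : z⁻¹ - 1 ≠ 0 := by
      intro h; exact h1 (inv_eq_one.mp (sub_eq_zero.mp h))
    have hI := Complex.I_ne_zero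
    field_simp
    ring

/-- The change of variables `T(θ) = M_β⁻¹(e^{iθ})`, which is real
(see `moebiusInv_exp_im`). -/
def lineParam (β θ : ℝ) : ℝ := (moebiusInv β (exp (θ * I))).re

open Classical in
/-- The `2π`-periodic function `F(θ) = f(T(θ))`. Where `e^{iθ} = 1` the point `T(θ)` is the point at
infinity of the line, and `F` is given the value `f(∞) = 0`. -/
def pullback (β : ℝ) (f : ℝ → ℂ) (θ : ℝ) : ℂ :=
  if exp (θ * I) = 1 then 0 else f (lineParam β θ)

/-- The discrete Fourier coefficient `(1 / n) ∑_{l < n} e^{-ijθ_l} F(θ_l)`, `θ_l = 2πl/n`. -/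
def discreteCoeff (n : ℕ) (F : ℝ → ℂ) (j : ℤ) : ℂ :=
  (1 / n : ℂ) * ∑ l ∈ Finset.range n,
    exp (-(I * j * (2 * Real.pi * l / n : ℝ))) * F (2 * Real.pi * l / n)

/-- The rational interpolant `𝓡ₙ f(x) = ∑_{j = -n₋}^{n₊} F̃_j M_β(x)^j`, with `F̃_j` the discrete
Fourier coefficients of `F = f ∘ T`, `n₊ = ⌊n/2⌋` and `n₋ = ⌊(n-1)/2⌋`; that is, the trigonometric
interpolant of `F` at `T⁻¹(x)`, as `e^{i T⁻¹(x)} = M_β(x)`. -/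
def ratInterp (β : ℝ) (n : ℕ) (f : ℝ → ℂ) (x : ℝ) : ℂ :=
  ∑ j ∈ Finset.Icc (-(((n - 1) / 2 : ℕ) : ℤ)) ((n / 2 : ℕ) : ℤ),
    discreteCoeff n (pullback β f) j * moebius β x ^ j

/-! ### Oscillatory Cauchy integrals -/

/-- The integrand `e^{-ikx} f(x) / (x - z)`. -/
def cauchyIntegrand (k : ℝ) (f : ℝ → ℂ) (z : ℂ) (x : ℝ) : ℂ :=
  exp (-(I * k * x)) * f x / (x - z)

/-- The oscillatory Cauchy integral `(1 / 2πi) ∫ e^{-ikx} f(x) / (x - z) dx`, for `z ∉ ℝ`. -/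
def oscCauchy (k : ℝ) (f : ℝ → ℂ) (z : ℂ) : ℂ :=
  1 / (2 * Real.pi * I) * ∫ x : ℝ, cauchyIntegrand k f z x

/-- The approximation `𝓒_{ℝ,k,n} f = 𝓒_{ℝ,k} 𝓡ₙ f`. -/
def oscCauchyApprox (β k : ℝ) (n : ℕ) (f : ℝ → ℂ) (z : ℂ) : ℂ :=
  oscCauchy k (ratInterp β n f) z

/-- The boundary values `Φ^±(x) = lim_{ε → 0+} Φ(x ± iε)` of a function `Φ` on `ℂ \ ℝ`. -/
def boundaryValue (σ : ℤˣ) (Φ : ℂ → ℂ) (x : ℝ) : ℂ :=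
  limUnder (𝓝[>] (0 : ℝ)) fun ε : ℝ => Φ (x + ((σ : ℤ) : ℂ) * ε * I)

/-- The restriction of `Φ` to the line `ℝ ± iδ` as a function of `x ∈ ℝ`; for `δ = 0` it is the
boundary value `Φ^±`. -/
def lineTrace (σ : ℤˣ) (δ : ℝ) (Φ : ℂ → ℂ) (x : ℝ) : ℂ :=
  if δ = 0 then boundaryValue σ Φ x else Φ (x + ((σ : ℤ) : ℂ) * δ * I)

/-- The error `𝓒_{ℝ,k} f - 𝓒_{ℝ,k,n} f` on the line `ℝ ± iδ`. -/
def lineError (β k : ℝ) (n : ℕ) (f : ℝ → ℂ) (σ : ℤˣ) (δ : ℝ) (x : ℝ) : ℂ :=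
  lineTrace σ δ (oscCauchy k f) x - lineTrace σ δ (oscCauchyApprox β k n f) x

end OscCauchy

end

open MeasureTheory Filter Topology OscCauchy

/-! Two independent facts carry the proof: the Cauchy integral is a contractive Fourier multiplier
up to a frequency shift, and the interpolation error is a series of aliased differences `M^a - M^b`.

Multiplier. If `v` is the Plancherel transform of `f`, then on `ℝ ± iδ` the Cauchy integral of
`e^{-ikx} f` is the inverse Fourier integral of `±1_{±t>0} e^{-2πδ|t|} v(t + k/2π)`
(`oscCauchy_eq_fourierInv`). The multiplier has modulus at most one, which gives the `L²` bound. In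
`H¹` the shift costs `1 + |ξ| ≤ (1 + |k|)(1 + |ξ + k|)`. For `f ∈ H¹` the density is integrable, so
dominated convergence gives the boundary values. Its modulus is largest at `δ = 0`, and its `L¹`
norm is at most its weighted `L²` norm, whence the supremum bound (`sobolevNorm_lineTrace_sub_le`).

Interpolation. As `f` vanishes at infinity, `F` is continuous; its coefficients `a_j` are summable
since `s > 1`, so `f = ∑ a_j M^j` pointwise. At the nodes frequencies congruent modulo `n` coincide,
so `𝓡ₙ f = ∑ a_j M^{r(j)}` with `r(j)` the representative of `j` (`hasSum_ratInterp`). The error is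
`∑ a_j (M^{r(j)} - M^j)`, and only `|j| ≥ n/2` contributes. No power of `M` lies in `L²(ℝ)`, but
`‖M^a - M^b‖ ≲ |a - b|^{1/2}`; hence the `L²` error is at most a multiple of `∑_{|j| ≥ n/2}
|j|^{1/2} |a_j|`, and Cauchy–Schwarz yields `n^{1+ε-s}`. For the derivative, `(M^j)' = i j ρ M^j`
with `ρ = 2β/(x² + β²)`; the powers are orthogonal for `ρ dx` and `ρ` is bounded, so Parseval yields
the better rate `n^{1-s}` (`eLpNorm_alias_deriv_le`). These bounds hold for finite partial sums and
pass to the limit by lower semicontinuity of the `H¹` norm. -/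

noncomputable section

open MeasureTheory Filter Topology Complex FourierTransform SchwartzMap
open scoped ENNReal

namespace OscCauchy


/-! ### The Fourier transform on `L²(ℝ)` -/

/-- The Plancherel transform of a square integrable function, with kernel `e^{-2πitx}`. -/
def fourierL2 (h : ℝ → ℂ) (hh : MemLp h 2 volume) : ℝ → ℂ :=
  (𝓕 (hh.toLp h) : Lp ℂ 2 (volume : Measure ℝ))

theorem memLp_fourierL2 (h : ℝ → ℂ) (hh : MemLp h 2 volume) :
    MemLp (fourierL2 h hh) 2 volume := Lp.memLp _

/-- Smooth compactly supported real functions become Schwartz functions after complexification, and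
they already separate locally integrable functions. Identities for the `L²` transform are therefore
checked by pairing with Schwartz functions. -/
theorem ae_eq_of_integral_schwartz_eq {u v : ℝ → ℂ} (hu : LocallyIntegrable u)
    (hv : LocallyIntegrable v) (h : ∀ φ : 𝓢(ℝ, ℂ), ∫ x, φ x * u x = ∫ x, φ x * v x) :
    u =ᵐ[volume] v := by
  refine ae_eq_of_integral_contDiff_smul_eq hu hv fun g hg hc => ?_
  have hc' : HasCompactSupport (Complex.ofRealCLM ∘ g) := hc.comp_left rfl
  have hg' : ContDiff ℝ ((⊤ : ℕ∞) : WithTop ℕ∞) (Complex.ofRealCLM ∘ g) := by fun_prop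
  simpa using! h (hc'.toSchwartzMap hg')

theorem integral_schwartz_mul_fourier (h : Lp ℂ 2 (volume : Measure ℝ)) (φ : 𝓢(ℝ, ℂ)) :
    ∫ t, φ t * (𝓕 h : Lp ℂ 2 (volume : Measure ℝ)) t = ∫ x, 𝓕 (φ : ℝ → ℂ) x * h x := by
  have := congrArg (fun T => T φ) (Lp.fourier_toTemperedDistribution_eq h)
  simp only [TemperedDistribution.fourier_apply, Lp.toTemperedDistribution_apply] at this
  simpa [SchwartzMap.fourier_coe] using this.symm

theorem integral_schwartz_mul_fourierInv (h : Lp ℂ 2 (volume : Measure ℝ)) (φ : 𝓢(ℝ, ℂ)) :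
    ∫ t, φ t * (𝓕⁻ h : Lp ℂ 2 (volume : Measure ℝ)) t = ∫ x, 𝓕⁻ (φ : ℝ → ℂ) x * h x := by
  have := congrArg (fun T => T φ) (Lp.fourierInv_toTemperedDistribution_eq h)
  simp only [TemperedDistribution.fourierInv_apply, Lp.toTemperedDistribution_apply] at this
  simpa [SchwartzMap.fourierInv_coe] using this.symm

theorem integral_mul_fourier_eq {u v : ℝ → ℂ} (hu : Integrable u) (hv : Integrable v) :
    ∫ x, 𝓕 u x * v x = ∫ x, u x * 𝓕 v x := by
  have := VectorFourier.integral_fourierIntegral_smul_eq_flip (L := innerₗ ℝ)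
    Real.continuous_fourierChar continuous_inner hu hv
  simpa [Real.fourier_eq, VectorFourier.fourierIntegral, mul_comm] using this

theorem integral_mul_fourierInv_eq {u v : ℝ → ℂ} (hu : Integrable u) (hv : Integrable v) :
    ∫ x, 𝓕⁻ u x * v x = ∫ x, u x * 𝓕⁻ v x := by
  have := VectorFourier.integral_fourierIntegral_smul_eq_flip (L := -innerₗ ℝ)
    Real.continuous_fourierChar continuous_inner.neg hu hv
  simpa [Real.fourierInv_eq, VectorFourier.fourierIntegral, mul_comm] using this

theorem continuous_fourier_of_integrable {w : ℝ → ℂ} (hw : Integrable w) : Continuous (𝓕 w) :=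
  VectorFourier.fourierIntegral_continuous Real.continuous_fourierChar
    (L := innerₗ ℝ) continuous_inner hw

theorem continuous_fourierInv_of_integrable {w : ℝ → ℂ} (hw : Integrable w) :
    Continuous (𝓕⁻ w) :=
  VectorFourier.fourierIntegral_continuous Real.continuous_fourierChar
    (L := -innerₗ ℝ) continuous_inner.neg hw

/-- On `L¹ ∩ L²` the abstract transform agrees with the integral, because both have the same pairing
with every Schwartz function. -/
theorem fourierInv_toLp_ae_eq {w : ℝ → ℂ} (hw : Integrable w) (hw2 : MemLp w 2 volume) :
    (𝓕⁻ (hw2.toLp w) : Lp ℂ 2 (volume : Measure ℝ)) =ᵐ[volume] 𝓕⁻ w := by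
  refine ae_eq_of_integral_schwartz_eq ((Lp.memLp _).locallyIntegrable one_le_two)
    (continuous_fourierInv_of_integrable hw).locallyIntegrable fun φ => ?_
  rw [integral_schwartz_mul_fourierInv, ← integral_mul_fourierInv_eq φ.integrable hw]
  refine integral_congr_ae ?_
  filter_upwards [hw2.coeFn_toLp] with x hx
  rw [hx]

theorem fourier_toLp_ae_eq {w : ℝ → ℂ} (hw : Integrable w) (hw2 : MemLp w 2 volume) :
    (𝓕 (hw2.toLp w) : Lp ℂ 2 (volume : Measure ℝ)) =ᵐ[volume] 𝓕 w := by
  refine ae_eq_of_integral_schwartz_eq ((Lp.memLp _).locallyIntegrable one_le_two)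
    (continuous_fourier_of_integrable hw).locallyIntegrable fun φ => ?_
  rw [integral_schwartz_mul_fourier, ← integral_mul_fourier_eq φ.integrable hw]
  refine integral_congr_ae ?_
  filter_upwards [hw2.coeFn_toLp] with x hx
  rw [hx]

theorem memLp_fourierInv {w : ℝ → ℂ} (hw : Integrable w) (hw2 : MemLp w 2 volume) :
    MemLp (𝓕⁻ w) 2 volume :=
  (memLp_congr_ae (fourierInv_toLp_ae_eq hw hw2)).mp (Lp.memLp _)

theorem fourierL2_fourierInv {w : ℝ → ℂ} (hw : Integrable w) (hw2 : MemLp w 2 volume)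
    (h : MemLp (𝓕⁻ w) 2 volume) : fourierL2 (𝓕⁻ w) h =ᵐ[volume] w := by
  have h1 : h.toLp (𝓕⁻ w) = 𝓕⁻ (hw2.toLp w) :=
    Lp.ext (h.coeFn_toLp.trans (fourierInv_toLp_ae_eq hw hw2).symm)
  unfold fourierL2
  rw [h1, FourierTransform.fourier_fourierInv_eq]
  exact hw2.coeFn_toLp

/-- Fourier inversion for continuous square integrable functions whose Plancherel transform is
integrable. -/
theorem eq_fourierInv_fourierL2 {h : ℝ → ℂ} (hc : Continuous h) (hh : MemLp h 2 volume)
    (hv : Integrable (fourierL2 h hh)) : h = 𝓕⁻ (fourierL2 h hh) := by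
  refine (Continuous.ae_eq_iff_eq volume hc (continuous_fourierInv_of_integrable hv)).mp ?_
  have h1 := fourierInv_toLp_ae_eq hv (memLp_fourierL2 h hh)
  have h2 : (memLp_fourierL2 h hh).toLp _ = 𝓕 (hh.toLp h) := Lp.toLp_coeFn _ _
  rw [h2, FourierTransform.fourierInv_fourier_eq] at h1
  exact hh.coeFn_toLp.symm.trans h1

/-- The Fourier transform is self-adjoint for the bilinear pairing on `L²`. -/
theorem integral_mul_fourier_L2 (h φ : Lp ℂ 2 (volume : Measure ℝ)) :
    ∫ x, h x * (𝓕 φ : Lp ℂ 2 (volume : Measure ℝ)) x =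
      ∫ t, (𝓕 h : Lp ℂ 2 (volume : Measure ℝ)) t * φ t := by
  have key : ∀ a b : Lp ℂ 2 (volume : Measure ℝ), ∫ x, a x * b x =
      (ContinuousLinearMap.mul ℂ ℂ).lpPairing volume 2 2 a b := fun a b => by
    simp [ContinuousLinearMap.lpPairing_eq_integral]
  -- Both sides are continuous in `φ`, so it suffices to treat the dense set of Schwartz functions.
  refine DenseRange.induction_on (p := fun φ : Lp ℂ 2 (volume : Measure ℝ) =>
    ∫ x, h x * (𝓕 φ : Lp ℂ 2 (volume : Measure ℝ)) x =
      ∫ t, (𝓕 h : Lp ℂ 2 (volume : Measure ℝ)) t * φ t)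
    (SchwartzMap.denseRange_toLpCLM (p := 2) ENNReal.ofNat_ne_top) φ ?_ ?_
  · simp only [key]
    refine isClosed_eq ?_ ?_
    · exact (ContinuousLinearMap.continuous _).comp (continuous_fourier)
    · exact ContinuousLinearMap.continuous _
  · intro ψ
    simp only [SchwartzMap.toLpCLM_apply]
    rw [SchwartzMap.toLp_fourier_eq]
    have h1 := integral_schwartz_mul_fourier h ψ
    rw [← SchwartzMap.fourier_coe] at h1
    calc _ = ∫ x, (𝓕 ψ) x * h x := by
          refine integral_congr_ae ?_
          filter_upwards [(𝓕 ψ).coeFn_toLp 2 volume] with x hx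
          rw [hx, mul_comm]
      _ = _ := h1.symm
      _ = _ := by
          refine integral_congr_ae ?_
          filter_upwards [ψ.coeFn_toLp 2 volume] with x hx
          rw [hx, mul_comm]

theorem integral_mul_fourier_eq_fourierL2 {h φ : ℝ → ℂ} (hh : MemLp h 2 volume)
    (hφ : Integrable φ) (hφ2 : MemLp φ 2 volume) :
    ∫ x, h x * 𝓕 φ x = ∫ t, fourierL2 h hh t * φ t := by
  have := integral_mul_fourier_L2 (hh.toLp h) (hφ2.toLp φ)
  calc _ = _ := integral_congr_ae ?_
    _ = _ := this
    _ = _ := integral_congr_ae ?_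
  · filter_upwards [hh.coeFn_toLp, fourier_toLp_ae_eq hφ hφ2] with x h1 h2
    rw [h1, h2]
  · filter_upwards [hφ2.coeFn_toLp] with x h1
    rw [h1]; rfl

theorem integral_schwartz_mul_fourierL2 {h : ℝ → ℂ} (hh : MemLp h 2 volume) (φ : 𝓢(ℝ, ℂ)) :
    ∫ t, φ t * fourierL2 h hh t = ∫ x, (𝓕 φ : 𝓢(ℝ, ℂ)) x * h x := by
  unfold fourierL2
  rw [integral_schwartz_mul_fourier, ← SchwartzMap.fourier_coe]
  refine integral_congr_ae ?_
  filter_upwards [hh.coeFn_toLp] with x h1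
  rw [h1]

theorem eLpNorm_fourierL2 (h : ℝ → ℂ) (hh : MemLp h 2 volume) :
    eLpNorm (fourierL2 h hh) 2 volume = eLpNorm h 2 volume := by
  have := Lp.norm_fourier_eq (hh.toLp h)
  rw [← eLpNorm_congr_ae hh.coeFn_toLp]
  have h1 := congrArg ENNReal.ofReal this
  rw [Lp.norm_def, Lp.norm_def, ENNReal.ofReal_toReal (Lp.memLp _).2.ne,
    ENNReal.ofReal_toReal (Lp.memLp _).2.ne] at h1
  exact h1

theorem schwartz_memLp_two (φ : 𝓢(ℝ, ℂ)) : MemLp φ 2 volume := φ.memLp 2 volume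

/-- Tested against a Schwartz `φ`, this is integration by parts of `g` against `𝓕 φ`, whose
derivative is `-𝓕 (2πit φ)`. Every product involved is a product of two `L²` functions, hence
integrable, so no boundary terms arise. -/
theorem fourierL2_deriv {g g' : ℝ → ℂ} (hg : MemLp g 2 volume) (hg' : MemLp g' 2 volume)
    (hd : ∀ x, HasDerivAt g (g' x) x) :
    fourierL2 g' hg' =ᵐ[volume] fun t => 2 * Real.pi * I * t * fourierL2 g hg t := by
  refine ae_eq_of_integral_schwartz_eq ((memLp_fourierL2 _ _).locallyIntegrable one_le_two)
    ?_ fun φ => ?_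
  · have : LocallyIntegrable (fourierL2 g hg) :=
      (memLp_fourierL2 _ _).locallyIntegrable one_le_two
    exact this.continuous_mul (by fun_prop)
  · have hT : Function.HasTemperateGrowth (fun t : ℝ => (2 * Real.pi * I * t : ℂ)) := by
      fun_prop
    set ψ : 𝓢(ℝ, ℂ) := SchwartzMap.smulLeftCLM ℂ (fun t : ℝ => (2 * Real.pi * I * t : ℂ)) φ
      with hψ
    have e1 : ∀ t, ψ t = 2 * Real.pi * I * t * φ t := fun t => by
      rw [hψ, SchwartzMap.smulLeftCLM_apply_apply hT, smul_eq_mul]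
    have e2 : ∀ t, HasDerivAt (𝓕 (φ : ℝ → ℂ)) (-(𝓕 (ψ : ℝ → ℂ) t)) t := fun t => by
      have hi : Integrable (fun x : ℝ => x • φ x) := by
        have : (fun x : ℝ => x • φ x) = fun x => (2 * Real.pi * I : ℂ)⁻¹ * ψ x := by
          ext x; rw [e1]; field_simp [Real.pi_ne_zero, I_ne_zero]; simp
        rw [this]; exact ψ.integrable.const_mul _
      have := Real.hasDerivAt_fourier φ.integrable hi t
      have e : -(𝓕 (ψ : ℝ → ℂ) t) = 𝓕 (fun x : ℝ => (-2 * Real.pi * I * x : ℂ) • φ x) t := by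
        rw [Real.fourier_eq, Real.fourier_eq, ← integral_neg]
        congr 1; ext x
        rw [e1]; simp only [Circle.smul_def, smul_eq_mul]; ring
      rw [e]; exact this
    rw [integral_schwartz_mul_fourierL2]
    have e3 : ∀ t, φ t * (2 * Real.pi * I * t * fourierL2 g hg t) = ψ t * fourierL2 g hg t :=
      fun t => by rw [e1]; ring
    simp_rw [e3]
    rw [integral_schwartz_mul_fourierL2]
    have e4 := integral_mul_deriv_eq_deriv_mul_of_integrable (u := (𝓕 φ : 𝓢(ℝ, ℂ)))
      (v := g) (u' := fun t => -(𝓕 ψ : 𝓢(ℝ, ℂ)) t) (v' := g') (fun x _ => e2 x) (fun x _ => hd x)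
      ((schwartz_memLp_two (𝓕 φ)).integrable_mul hg')
      (((schwartz_memLp_two (𝓕 ψ)).neg).integrable_mul hg)
      ((schwartz_memLp_two (𝓕 φ)).integrable_mul hg)
    rw [e4, ← integral_neg]
    congr 1; ext x; ring


/-! ### The norm of `H¹(ℝ)` -/

/-- The weighted rescaling `ξ ↦ (1 + |ξ|) u(ξ / 2π)`, whose `L²` norm is the `H¹` norm when `u` is the
Plancherel transform. -/
def sobolevWeight (u : ℝ → ℂ) (ξ : ℝ) : ℂ := ((1 + |ξ| : ℝ) : ℂ) * u (ξ / (2 * Real.pi))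

theorem map_div_two_pi :
    Measure.map (fun ξ : ℝ => ξ / (2 * Real.pi)) volume =
      ENNReal.ofReal (2 * Real.pi) • (volume : Measure ℝ) := by
  have := Real.map_volume_mul_right (a := (2 * Real.pi)⁻¹) (by positivity)
  simpa [div_eq_mul_inv, abs_of_pos Real.pi_pos] using this

theorem quasiMeasurePreserving_div_two_pi :
    Measure.QuasiMeasurePreserving (fun ξ : ℝ => ξ / (2 * Real.pi)) volume volume := by
  refine ⟨by fun_prop, ?_⟩
  rw [map_div_two_pi]
  exact Measure.smul_absolutelyContinuous

theorem sobolevWeight_congr {u v : ℝ → ℂ} (h : u =ᵐ[volume] v) :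
    sobolevWeight u =ᵐ[volume] sobolevWeight v := by
  filter_upwards [quasiMeasurePreserving_div_two_pi.ae_eq_comp h] with ξ hξ
  simp only [Function.comp_apply] at hξ
  simp [sobolevWeight, hξ]

theorem aestronglyMeasurable_div_two_pi {u : ℝ → ℂ} (hu : AEStronglyMeasurable u) :
    AEStronglyMeasurable (fun ξ : ℝ => u (ξ / (2 * Real.pi))) :=
  hu.comp_quasiMeasurePreserving quasiMeasurePreserving_div_two_pi

theorem aestronglyMeasurable_sobolevWeight {u : ℝ → ℂ} (hu : AEStronglyMeasurable u) :
    AEStronglyMeasurable (sobolevWeight u) := by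
  have : Continuous fun ξ : ℝ => ((1 + |ξ| : ℝ) : ℂ) := by fun_prop
  exact this.aestronglyMeasurable.mul (aestronglyMeasurable_div_two_pi hu)

theorem eLpNorm_div_two_pi {u : ℝ → ℂ} (hu : AEStronglyMeasurable u) {p : ℝ≥0∞} (hp : p ≠ ∞) :
    eLpNorm (fun ξ : ℝ => u (ξ / (2 * Real.pi))) p volume =
      ENNReal.ofReal (2 * Real.pi) ^ (1 / p).toReal * eLpNorm u p volume := by
  have h1 : AEStronglyMeasurable u (Measure.map (fun ξ : ℝ => ξ / (2 * Real.pi)) volume) := by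
    rw [map_div_two_pi]; exact hu.smul_measure _
  have := eLpNorm_map_measure (p := p) h1 (by fun_prop)
  rw [map_div_two_pi, eLpNorm_smul_measure_of_ne_top hp] at this
  simpa [Function.comp_def] using this.symm

theorem sobolevNorm_one_eq (h : ℝ → ℂ) (hh : MemLp h 2 volume) :
    sobolevNorm 1 h = eLpNorm (sobolevWeight (fourierL2 h hh)) 2 volume := by
  rw [sobolevNorm, dif_pos hh, eLpNorm_eq_lintegral_rpow_enorm_toReal two_ne_zero
    ENNReal.ofNat_ne_top]
  simp only [ENNReal.toReal_ofNat]
  congr 1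
  refine lintegral_congr fun ξ => ?_
  have e : lineFourier h hh ξ = fourierL2 h hh (ξ / (2 * Real.pi)) := rfl
  have h0 : 0 ≤ 1 + |ξ| := by positivity
  rw [ENNReal.rpow_ofNat, ← ofReal_norm, ← ENNReal.ofReal_pow (norm_nonneg _),
    sobolevWeight, norm_mul, mul_pow, Complex.norm_real, Real.norm_of_nonneg h0, e]
  norm_num

theorem MemSobolevLine.memLp_weight {h : ℝ → ℂ} (hs : MemSobolevLine 1 h) :
    eLpNorm (sobolevWeight (fourierL2 h hs.1)) 2 volume < ∞ := by
  rw [← sobolevNorm_one_eq]; exact hs.2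

/-- The bound is generous: the constant `2π` is chosen to equal the Jacobian of `ξ ↦ ξ / 2π`, so
that the two cancel in `lintegral_enorm_le_sobolevWeight` and the supremum is bounded by the `H¹`
norm with constant one. -/
theorem eLpNorm_inv_one_add_abs_le :
    eLpNorm (fun ξ : ℝ => ((1 + |ξ| : ℝ) : ℂ)⁻¹) 2 volume ≤ ENNReal.ofReal (2 * Real.pi) := by
  rw [eLpNorm_eq_lintegral_rpow_enorm_toReal two_ne_zero ENNReal.ofNat_ne_top]
  simp only [ENNReal.toReal_ofNat]
  have h1 : ∫⁻ ξ : ℝ, ‖((1 + |ξ| : ℝ) : ℂ)⁻¹‖ₑ ^ (2 : ℝ) ≤ ENNReal.ofReal Real.pi := by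
    rw [← integral_univ_inv_one_add_sq, ofReal_integral_eq_lintegral_ofReal
      integrable_inv_one_add_sq (ae_of_all _ fun x => by positivity)]
    refine lintegral_mono fun ξ => ?_
    have h0 : 0 < 1 + |ξ| := by positivity
    rw [ENNReal.rpow_ofNat, ← ofReal_norm, ← ENNReal.ofReal_pow (norm_nonneg _)]
    refine ENNReal.ofReal_le_ofReal ?_
    rw [norm_inv, Complex.norm_real, Real.norm_of_nonneg h0.le, inv_pow]
    refine inv_anti₀ (by positivity) ?_
    nlinarith [abs_nonneg ξ, sq_abs ξ]
  calc _ ≤ ENNReal.ofReal Real.pi ^ (1 / 2 : ℝ) := by gcongr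
    _ ≤ ENNReal.ofReal (2 * Real.pi) := by
      rw [ENNReal.ofReal_rpow_of_pos Real.pi_pos]
      refine ENNReal.ofReal_le_ofReal ?_
      calc Real.pi ^ (1 / 2 : ℝ) ≤ Real.pi ^ (1 : ℝ) :=
            Real.rpow_le_rpow_of_exponent_le (by linarith [Real.pi_gt_three]) (by norm_num)
        _ ≤ 2 * Real.pi := by rw [Real.rpow_one]; linarith [Real.pi_pos]

/-- The `L¹` norm of the Fourier transform is controlled by the `H¹` norm. -/
theorem lintegral_enorm_le_sobolevWeight {u : ℝ → ℂ} (hu : AEStronglyMeasurable u) :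
    ∫⁻ t, ‖u t‖ₑ ≤ eLpNorm (sobolevWeight u) 2 volume := by
  have h1 := eLpNorm_div_two_pi hu (p := 1) ENNReal.one_ne_top
  have h2 : (fun ξ : ℝ => u (ξ / (2 * Real.pi))) =
      (fun ξ : ℝ => ((1 + |ξ| : ℝ) : ℂ)⁻¹) • sobolevWeight u := by
    ext ξ
    have h0 : ((1 + |ξ| : ℝ) : ℂ) ≠ 0 := by
      exact_mod_cast (by positivity : (0 : ℝ) < 1 + |ξ|).ne'
    simp only [Pi.smul_apply', smul_eq_mul, sobolevWeight]
    rw [inv_mul_cancel_left₀ h0]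
  have hm : AEStronglyMeasurable (fun ξ : ℝ => ((1 + |ξ| : ℝ) : ℂ)⁻¹) := by
    have : Continuous (fun ξ : ℝ => ((1 + |ξ| : ℝ) : ℂ)) := by fun_prop
    exact (this.measurable.inv).aestronglyMeasurable
  have h3 : eLpNorm (fun ξ : ℝ => u (ξ / (2 * Real.pi))) 1 volume ≤
      ENNReal.ofReal (2 * Real.pi) * eLpNorm (sobolevWeight u) 2 volume := by
    rw [h2]
    refine (eLpNorm_smul_le_mul_eLpNorm (p := 2) (q := 2)
      (aestronglyMeasurable_sobolevWeight hu) hm).trans ?_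
    gcongr
    exact eLpNorm_inv_one_add_abs_le
  rw [h1, eLpNorm_one_eq_lintegral_enorm] at h3
  have hpos : ENNReal.ofReal (2 * Real.pi) ≠ 0 := by
    rw [Ne, ENNReal.ofReal_eq_zero, not_le]; positivity
  simp only [div_one, ENNReal.toReal_one, ENNReal.rpow_one] at h3
  exact (ENNReal.mul_le_mul_iff_right hpos ENNReal.ofReal_ne_top).mp h3

theorem MemSobolevLine.integrable_fourierL2 {h : ℝ → ℂ} (hs : MemSobolevLine 1 h) :
    Integrable (fourierL2 h hs.1) :=
  ⟨(memLp_fourierL2 _ _).1,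
    (lintegral_enorm_le_sobolevWeight (memLp_fourierL2 _ _).1).trans_lt hs.memLp_weight⟩

theorem fourierL2_sub {g h : ℝ → ℂ} (hg : MemLp g 2 volume) (hh : MemLp h 2 volume)
    (hgh : MemLp (fun x => g x - h x) 2 volume) :
    fourierL2 (fun x => g x - h x) hgh =ᵐ[volume]
      fun t => fourierL2 g hg t - fourierL2 h hh t := by
  have : hgh.toLp (fun x => g x - h x) = hg.toLp g - hh.toLp h := MemLp.toLp_sub hg hh
  unfold fourierL2
  have h1 : 𝓕 (hg.toLp g - hh.toLp h) = 𝓕 (hg.toLp g) - 𝓕 (hh.toLp h) :=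
    (Lp.fourierTransformₗᵢ ℝ ℂ).map_sub _ _
  rw [this, h1]
  exact Lp.coeFn_sub _ _

/-- The `H¹` norm is controlled by the `L²` norms of the function and of its derivative. -/
theorem sobolevNorm_one_le {g g' : ℝ → ℂ} (hg : MemLp g 2 volume) (hg' : MemLp g' 2 volume)
    (hd : ∀ x, HasDerivAt g (g' x) x) :
    sobolevNorm 1 g ≤ ENNReal.ofReal (2 * Real.pi) * (eLpNorm g 2 volume + eLpNorm g' 2 volume) := by
  rw [sobolevNorm_one_eq g hg]
  have e : sobolevWeight (fourierL2 g hg) = (fun ξ : ℝ => fourierL2 g hg (ξ / (2 * Real.pi))) +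
      fun ξ : ℝ => ((|ξ| : ℝ) : ℂ) * fourierL2 g hg (ξ / (2 * Real.pi)) := by
    ext ξ; simp only [sobolevWeight, Pi.add_apply]; push_cast; ring
  have hm : AEStronglyMeasurable (fun ξ : ℝ => fourierL2 g hg (ξ / (2 * Real.pi))) :=
    aestronglyMeasurable_div_two_pi (memLp_fourierL2 _ _).1
  have hm' : AEStronglyMeasurable (fun ξ : ℝ => ((|ξ| : ℝ) : ℂ) * fourierL2 g hg (ξ / (2 * Real.pi))) :=
    (by fun_prop : Continuous fun ξ : ℝ => ((|ξ| : ℝ) : ℂ)).aestronglyMeasurable.mul hm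
  -- After rescaling, the transform of `g'` is `iξ` times that of `g`, so the moduli agree.
  have h2 : eLpNorm (fun ξ : ℝ => ((|ξ| : ℝ) : ℂ) * fourierL2 g hg (ξ / (2 * Real.pi))) 2 volume =
      eLpNorm (fun ξ : ℝ => fourierL2 g' hg' (ξ / (2 * Real.pi))) 2 volume := by
    refine eLpNorm_congr_norm_ae ?_
    filter_upwards [quasiMeasurePreserving_div_two_pi.ae_eq_comp (fourierL2_deriv hg hg' hd)]
      with ξ hξ
    simp only [Function.comp_apply] at hξ
    rw [hξ, norm_mul, norm_mul]
    congr 1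
    have : (2 * Real.pi * I * ((ξ / (2 * Real.pi) : ℝ) : ℂ)) = I * ξ := by
      push_cast; field_simp [Real.pi_ne_zero]
    rw [this]; simp
  have hc : ENNReal.ofReal (2 * Real.pi) ^ (1 / (2 : ℝ≥0∞)).toReal ≤ ENNReal.ofReal (2 * Real.pi) := by
    have h1 : (1 : ℝ≥0∞) ≤ ENNReal.ofReal (2 * Real.pi) := by
      rw [← ENNReal.ofReal_one]
      exact ENNReal.ofReal_le_ofReal (by linarith [Real.pi_gt_three])
    calc _ ≤ ENNReal.ofReal (2 * Real.pi) ^ (1 : ℝ) := by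
          refine ENNReal.rpow_le_rpow_of_exponent_le h1 ?_
          simp; norm_num
      _ = _ := ENNReal.rpow_one _
  rw [e]
  refine (eLpNorm_add_le hm hm' one_le_two).trans ?_
  rw [h2, eLpNorm_div_two_pi (memLp_fourierL2 _ _).1 ENNReal.ofNat_ne_top,
    eLpNorm_div_two_pi (memLp_fourierL2 _ _).1 ENNReal.ofNat_ne_top, eLpNorm_fourierL2,
    eLpNorm_fourierL2, mul_add]
  gcongr

/-- Lower semicontinuity of the `H¹` norm under `L²` convergence. -/
theorem sobolevNorm_one_le_of_tendsto {g : ℝ → ℂ} {G : ℕ → ℝ → ℂ} (hg : MemLp g 2 volume)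
    (hG : ∀ N, MemLp (G N) 2 volume)
    (hlim : Tendsto (fun N => eLpNorm (fun x => G N x - g x) 2 volume) atTop (𝓝 0)) {B : ℝ≥0∞}
    (hB : ∀ N, sobolevNorm 1 (G N) ≤ B) : sobolevNorm 1 g ≤ B := by
  have h1 : Tendsto (fun N => eLpNorm (fourierL2 (G N) (hG N) - fourierL2 g hg) 2 volume) atTop
      (𝓝 0) := by
    refine hlim.congr fun N => ?_
    have hs : MemLp (fun x => G N x - g x) 2 volume := (hG N).sub hg
    rw [← eLpNorm_fourierL2 _ hs]
    exact eLpNorm_congr_ae (fourierL2_sub (hG N) hg hs)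
  -- By Plancherel the transforms converge in `L²`, so a subsequence converges almost everywhere and
  -- Fatou's lemma applies to the weighted transforms.
  obtain ⟨ns, -, hns⟩ := (tendstoInMeasure_of_tendsto_eLpNorm two_ne_zero
    (fun N => (memLp_fourierL2 (G N) (hG N)).1) (memLp_fourierL2 g hg).1 h1).exists_seq_tendsto_ae
  rw [sobolevNorm_one_eq g hg]
  refine (Lp.eLpNorm_lim_le_liminf_eLpNorm
    (f := fun i => sobolevWeight (fourierL2 (G (ns i)) (hG (ns i))))
    (fun i => aestronglyMeasurable_sobolevWeight (memLp_fourierL2 _ _).1) _ ?_).trans ?_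
  · filter_upwards [quasiMeasurePreserving_div_two_pi.ae hns] with ξ hξ
    exact hξ.const_mul _
  · simp_rw [← sobolevNorm_one_eq]
    refine (liminf_le_liminf (Eventually.of_forall fun i => hB (ns i))).trans ?_
    simp


/-! ### Cauchy integrals as Fourier multipliers -/

/-- The multiplier `±1_{±t > 0} e^{-2πδ|t|}` of the Cauchy integral on the line `ℝ ± iδ`. -/
def cauchyMultiplier (σ : ℤˣ) (δ t : ℝ) : ℂ :=
  if 0 < ((σ : ℤ) : ℝ) * t then ((σ : ℤ) : ℂ) * Real.exp (-(2 * Real.pi * δ * |t|)) else 0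

theorem norm_cauchyMultiplier (σ : ℤˣ) (δ t : ℝ) : ‖cauchyMultiplier σ δ t‖ =
    if 0 < ((σ : ℤ) : ℝ) * t then Real.exp (-(2 * Real.pi * δ * |t|)) else 0 := by
  unfold cauchyMultiplier
  split_ifs
  · rw [norm_mul, Complex.norm_real, Real.norm_of_nonneg (Real.exp_pos _).le]
    rcases Int.units_eq_one_or σ with rfl | rfl <;> simp
  · simp

theorem norm_cauchyMultiplier_le_zero (σ : ℤˣ) {δ : ℝ} (hδ : 0 ≤ δ) (t : ℝ) :
    ‖cauchyMultiplier σ δ t‖ ≤ ‖cauchyMultiplier σ 0 t‖ := by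
  rw [norm_cauchyMultiplier, norm_cauchyMultiplier]
  split_ifs
  · gcongr
  · rfl

theorem norm_cauchyMultiplier_le_one (σ : ℤˣ) {δ : ℝ} (hδ : 0 ≤ δ) (t : ℝ) :
    ‖cauchyMultiplier σ δ t‖ ≤ 1 := by
  refine (norm_cauchyMultiplier_le_zero σ hδ t).trans ?_
  rw [norm_cauchyMultiplier]
  split_ifs <;> simp

theorem measurable_cauchyMultiplier (σ : ℤˣ) (δ : ℝ) : Measurable (cauchyMultiplier σ δ) := by
  unfold cauchyMultiplier
  refine Measurable.ite (measurableSet_lt measurable_const (by fun_prop)) ?_ measurable_const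
  exact (by fun_prop : Continuous fun t : ℝ =>
    ((σ : ℤ) : ℂ) * (Real.exp (-(2 * Real.pi * δ * |t|)) : ℂ)).measurable

theorem integrable_cauchyMultiplier (σ : ℤˣ) {δ : ℝ} (hδ : 0 < δ) :
    Integrable (cauchyMultiplier σ δ) := by
  have h1 : Integrable fun t : ℝ => Real.exp (-(2 * Real.pi * δ) * |t|) := by
    have ha : 0 < 2 * Real.pi * δ := by positivity
    rw [← integrableOn_univ, ← Set.Iic_union_Ioi (a := (0 : ℝ))]
    refine IntegrableOn.union ?_ ?_
    · refine (integrableOn_exp_mul_Iic ha 0).congr_fun (fun t ht => ?_) measurableSet_Iic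
      simp only [abs_of_nonpos (Set.mem_Iic.mp ht)]; ring_nf
    · refine (integrableOn_exp_mul_Ioi (neg_lt_zero.mpr ha) 0).congr_fun (fun t ht => ?_)
        measurableSet_Ioi
      simp only [abs_of_pos (Set.mem_Ioi.mp ht)]
  refine h1.mono' (measurable_cauchyMultiplier σ δ).aestronglyMeasurable (ae_of_all _ fun t => ?_)
  rw [norm_cauchyMultiplier]
  split_ifs
  · simp
  · positivity

theorem memLp_two_of_integrable_of_norm_le_one {φ : ℝ → ℂ} (h1 : Integrable φ)
    (hb : ∀ t, ‖φ t‖ ≤ 1) : MemLp φ 2 volume := by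
  rw [memLp_two_iff_integrable_sq_norm h1.1]
  refine h1.norm.mono' (h1.1.norm.pow 2) (ae_of_all _ fun t => ?_)
  rw [Real.norm_of_nonneg (by positivity)]
  nlinarith [norm_nonneg (φ t), hb t]

/-- The Fourier transform of the multiplier is the Cauchy kernel. -/
theorem integral_cauchyMultiplier (σ : ℤˣ) {δ : ℝ} (hδ : 0 < δ) (x : ℝ) :
    ∫ t : ℝ, cauchyMultiplier σ δ t * exp (2 * Real.pi * I * x * t) =
      1 / (2 * Real.pi * I) * (1 / (-(x + ((σ : ℤ) : ℂ) * δ * I))) := by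
  have hpi : (Real.pi : ℂ) ≠ 0 := by exact_mod_cast Real.pi_ne_zero
  -- This real part is nonzero, and its sign selects the half-line on which the exponential decays:
  -- `t > 0` for `σ = 1`, `t < 0` for `σ = -1`.
  have hre : (2 * Real.pi * I * (x + ((σ : ℤ) : ℂ) * δ * I)).re = -(2 * Real.pi * ((σ : ℤ) : ℝ) * δ) := by
    simp; ring
  have hne : (2 * Real.pi * I * (x + ((σ : ℤ) : ℂ) * δ * I)) ≠ 0 := by
    intro h; rw [h] at hre
    rcases Int.units_eq_one_or σ with rfl | rfl <;> simp at hre <;>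
      rcases hre with h | h <;> linarith [Real.pi_pos]
  have hne' : (x + ((σ : ℤ) : ℂ) * δ * I) ≠ 0 := right_ne_zero_of_mul hne
  rcases Int.units_eq_one_or σ with rfl | rfl
  · have e : (fun t : ℝ => cauchyMultiplier 1 δ t * exp (2 * Real.pi * I * x * t)) =
        (Set.Ioi (0 : ℝ)).indicator fun t : ℝ =>
          exp (2 * Real.pi * I * (x + (((1 : ℤˣ) : ℤ) : ℂ) * δ * I) * t) := by
      ext t
      simp only [cauchyMultiplier, Set.indicator_apply, Set.mem_Ioi]
      by_cases ht : 0 < t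
      · simp only [ht, Units.val_one, Int.cast_one, one_mul, if_true, abs_of_pos ht]
        push_cast
        rw [← Complex.exp_add]; congr 1; ring_nf; rw [I_sq]; ring
      · simp [ht]
    rw [e, integral_indicator measurableSet_Ioi, integral_exp_mul_complex_Ioi]
    · simp only [ofReal_zero, mul_zero, Complex.exp_zero]
      field_simp
    · rw [hre]; simp; positivity
  · have e : (fun t : ℝ => cauchyMultiplier (-1) δ t * exp (2 * Real.pi * I * x * t)) =
        (Set.Iio (0 : ℝ)).indicator fun t : ℝ =>
          -exp (2 * Real.pi * I * (x + (((-1 : ℤˣ) : ℤ) : ℂ) * δ * I) * t) := by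
      ext t
      simp only [cauchyMultiplier, Set.indicator_apply, Set.mem_Iio]
      by_cases ht : t < 0
      · simp only [ht, Units.val_neg, Units.val_one, Int.cast_neg, Int.cast_one, neg_mul, one_mul,
          Left.neg_pos_iff, if_true, abs_of_neg ht]
        push_cast
        rw [← Complex.exp_add]; congr 2; ring_nf; rw [I_sq]; ring
      · simp [ht]
    rw [e, integral_indicator measurableSet_Iio, integral_neg, ← integral_Iic_eq_integral_Iio,
      integral_exp_mul_complex_Iic]
    · simp only [ofReal_zero, mul_zero, Complex.exp_zero]
      field_simp
    · rw [hre]; simp; positivity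

/-- The density whose inverse Fourier integral is the Cauchy integral of `e^{-ikx} f` on the line
`ℝ ± iδ`, given the Plancherel transform `v` of `f`. -/
def cauchyDensity (k : ℝ) (σ : ℤˣ) (δ : ℝ) (v : ℝ → ℂ) (t : ℝ) : ℂ :=
  cauchyMultiplier σ δ t * v (t + k / (2 * Real.pi))

/-- The kernel `e^{-iky} / (2πi (y - z))` is the Fourier transform of an explicit `φ ∈ L¹ ∩ L²`.
Moving the transform from `φ` onto `f` turns the Cauchy integral into `∫ v φ`; translating by `k /
2π` gives the density. -/
theorem oscCauchy_eq_fourierInv {f : ℝ → ℂ} (hf : MemLp f 2 volume) (k : ℝ) (σ : ℤˣ) {δ : ℝ}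
    (hδ : 0 < δ) (x : ℝ) : oscCauchy k f (x + ((σ : ℤ) : ℂ) * δ * I) =
      𝓕⁻ (cauchyDensity k σ δ (fourierL2 f hf)) x := by
  have hpi : (Real.pi : ℂ) ≠ 0 := by exact_mod_cast Real.pi_ne_zero
  set c : ℝ := k / (2 * Real.pi) with hc
  set φ : ℝ → ℂ := fun t => cauchyMultiplier σ δ (t - c) * exp (2 * Real.pi * I * x * (t - c))
    with hφ
  have hexp : ∀ a : ℝ, ‖exp (2 * Real.pi * I * x * a)‖ = 1 := fun a => by
    rw [show (2 * Real.pi * I * x * a : ℂ) = ((2 * Real.pi * x * a : ℝ) : ℂ) * I by push_cast; ring,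
      Complex.norm_exp_ofReal_mul_I]
  have hn : ∀ t, ‖φ t‖ = ‖cauchyMultiplier σ δ (t - c)‖ := fun t => by
    rw [hφ]; simp only [norm_mul]
    rw [← ofReal_sub, hexp, mul_one]
  have hφ1 : Integrable φ := by
    refine ((integrable_cauchyMultiplier σ hδ).comp_sub_right c).norm.mono' ?_
      (ae_of_all _ fun t => (hn t).le)
    exact ((measurable_cauchyMultiplier σ δ).comp (by fun_prop)).aestronglyMeasurable.mul
      (by fun_prop : Continuous fun t : ℝ => exp (2 * Real.pi * I * x * (t - c))).aestronglyMeasurable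
  have hφ2 : MemLp φ 2 volume := memLp_two_of_integrable_of_norm_le_one hφ1 fun t =>
    (hn t).le.trans (norm_cauchyMultiplier_le_one σ hδ.le _)
  have hF : ∀ y : ℝ, 𝓕 φ y =
      1 / (2 * Real.pi * I) * (exp (-(I * k * y)) / (y - (x + ((σ : ℤ) : ℂ) * δ * I))) := fun y => by
    have h1 : 𝓕 φ y = ∫ t : ℝ, exp (-(I * k * y)) * (cauchyMultiplier σ δ t *
        exp (2 * Real.pi * I * (x - y : ℝ) * t)) := by
      rw [Real.fourier_eq', ← integral_add_right_eq_self _ c]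
      refine integral_congr_ae (ae_of_all _ fun t => ?_)
      simp only [hφ, smul_eq_mul, add_sub_cancel_right]
      rw [← ofReal_sub, add_sub_cancel_right, mul_left_comm, mul_left_comm (exp (-(I * k * y))),
        ← Complex.exp_add, ← Complex.exp_add]
      congr 2
      simp only [hc, RCLike.inner_apply, conj_trivial]
      push_cast
      field_simp
      ring
    rw [h1, integral_const_mul, integral_cauchyMultiplier σ hδ]
    push_cast
    rw [show (-(x - y + ((σ : ℤ) : ℂ) * δ * I) : ℂ) = y - (x + ((σ : ℤ) : ℂ) * δ * I) by ring]
    ring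
  have key := integral_mul_fourier_eq_fourierL2 hf hφ1 hφ2
  rw [oscCauchy, ← integral_const_mul]
  calc _ = ∫ y, f y * 𝓕 φ y := by
        refine integral_congr_ae (ae_of_all _ fun y => ?_)
        simp only [hF, cauchyIntegrand]; ring
    _ = _ := key
    _ = _ := by
        rw [Real.fourierInv_eq', ← integral_add_right_eq_self _ c]
        refine integral_congr_ae (ae_of_all _ fun t => ?_)
        simp only [hφ, cauchyDensity, ← hc, smul_eq_mul, RCLike.inner_apply, conj_trivial]
        rw [← ofReal_sub, add_sub_cancel_right]
        push_cast
        rw [show (2 * Real.pi * I * x * t : ℂ) = 2 * Real.pi * (x * t) * I by ring]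
        ring

/-- Off the real axis `1 / (x - z)` is square integrable, with square a rescaled and translated `(1
+ x²)⁻¹`; the integrand is thus a product of two `L²` functions. -/
theorem integrable_cauchyIntegrand {f : ℝ → ℂ} (hf : MemLp f 2 volume) (k : ℝ) {z : ℂ}
    (hz : z.im ≠ 0) : Integrable (cauchyIntegrand k f z) := by
  have h0 : ∀ x : ℝ, (x : ℂ) - z ≠ 0 := fun x h => hz (by
    have := congrArg Complex.im h
    simpa using this)
  have hc : Continuous fun x : ℝ => exp (-(I * k * x)) / ((x : ℂ) - z) :=
    Continuous.div (by fun_prop) (by fun_prop) h0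
  have hm : MemLp (fun x : ℝ => exp (-(I * k * x)) / ((x : ℂ) - z)) 2 volume := by
    rw [memLp_two_iff_integrable_sq_norm hc.aestronglyMeasurable]
    have h1 : Integrable fun x : ℝ => (1 + ((x - z.re) / z.im) ^ 2)⁻¹ := by
      have := (integrable_inv_one_add_sq.comp_div hz).comp_sub_right z.re
      exact this
    refine (h1.const_mul ((z.im ^ 2)⁻¹)).congr (ae_of_all _ fun x => ?_)
    have e1 : ‖exp (-(I * k * x))‖ = 1 := by
      rw [show (-(I * k * x) : ℂ) = ((-(k * x) : ℝ) : ℂ) * I by push_cast; ring,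
        Complex.norm_exp_ofReal_mul_I]
    simp only [norm_div, e1, div_pow, one_pow]
    rw [Complex.sq_norm, Complex.normSq_apply]
    have : ((x : ℂ) - z).re = x - z.re := by simp
    have h2 : ((x : ℂ) - z).im = - z.im := by simp
    rw [this, h2]
    have h3 : (0 : ℝ) < z.im ^ 2 := by positivity
    have h4 : (x - z.re) * (x - z.re) + -z.im * -z.im ≠ 0 := by nlinarith [sq_nonneg (x - z.re)]
    field_simp
    ring
  have := hf.integrable_mul hm
  refine this.congr (ae_of_all _ fun x => ?_)
  simp only [Pi.mul_apply, cauchyIntegrand]; ring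

theorem integrable_cauchyDensity {v : ℝ → ℂ} (hv : Integrable v) (k : ℝ) (σ : ℤˣ) {δ : ℝ}
    (hδ : 0 ≤ δ) : Integrable (cauchyDensity k σ δ v) := by
  refine (hv.comp_add_right (k / (2 * Real.pi))).norm.mono'
    ((measurable_cauchyMultiplier σ δ).aestronglyMeasurable.mul
      (hv.comp_add_right (k / (2 * Real.pi))).1) (ae_of_all _ fun t => ?_)
  rw [cauchyDensity, norm_mul]
  exact mul_le_of_le_one_left (norm_nonneg _) (norm_cauchyMultiplier_le_one σ hδ t)

/-- Dominated convergence in the Fourier integral. The dominating function is the translated `|v|`,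
which is integrable because `f ∈ H¹`. -/
theorem tendsto_oscCauchy {f : ℝ → ℂ} (hf : MemSobolevLine 1 f) (k : ℝ) (σ : ℤˣ) (x : ℝ) :
    Tendsto (fun η : ℝ => oscCauchy k f (x + ((σ : ℤ) : ℂ) * η * I)) (𝓝[>] 0)
      (𝓝 (𝓕⁻ (cauchyDensity k σ 0 (fourierL2 f hf.1)) x)) := by
  have hv := hf.integrable_fourierL2
  have h1 : Tendsto (fun η : ℝ => 𝓕⁻ (cauchyDensity k σ η (fourierL2 f hf.1)) x) (𝓝[>] 0)
      (𝓝 (𝓕⁻ (cauchyDensity k σ 0 (fourierL2 f hf.1)) x)) := by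
    simp only [Real.fourierInv_eq]
    refine tendsto_integral_filter_of_dominated_convergence
      (fun t => ‖fourierL2 f hf.1 (t + k / (2 * Real.pi))‖) ?_ ?_
      (hv.comp_add_right (k / (2 * Real.pi))).norm ?_
    · filter_upwards [self_mem_nhdsWithin] with η hη
      have hη : 0 ≤ η := le_of_lt hη
      have h2 := integrable_cauchyDensity hv k σ hη
      exact ((Real.continuous_fourierChar.comp (by fun_prop)).aestronglyMeasurable).smul h2.1
    · filter_upwards [self_mem_nhdsWithin] with η hη
      have hη : 0 ≤ η := le_of_lt hη
      refine ae_of_all _ fun t => ?_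
      rw [Circle.norm_smul, cauchyDensity, norm_mul]
      exact mul_le_of_le_one_left (norm_nonneg _) (norm_cauchyMultiplier_le_one σ hη t)
    · refine ae_of_all _ fun t => Tendsto.const_smul ?_ _
      refine Tendsto.mul_const _ ?_
      refine Tendsto.mono_left ?_ nhdsWithin_le_nhds
      unfold cauchyMultiplier
      split_ifs
      · have : Continuous fun η : ℝ => ((σ : ℤ) : ℂ) * (Real.exp (-(2 * Real.pi * η * |t|)) : ℂ) := by
          fun_prop
        exact this.tendsto 0
      · exact tendsto_const_nhds
  refine h1.congr' ?_
  filter_upwards [self_mem_nhdsWithin] with η hη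
  exact (oscCauchy_eq_fourierInv hf.1 k σ hη x).symm

theorem boundaryValue_oscCauchy {f : ℝ → ℂ} (hf : MemSobolevLine 1 f) (k : ℝ) (σ : ℤˣ) (x : ℝ) :
    boundaryValue σ (oscCauchy k f) x = 𝓕⁻ (cauchyDensity k σ 0 (fourierL2 f hf.1)) x :=
  (tendsto_oscCauchy hf k σ x).limUnder_eq

theorem lineTrace_oscCauchy {f : ℝ → ℂ} (hf : MemSobolevLine 1 f) (k : ℝ) (σ : ℤˣ) {δ : ℝ}
    (hδ : 0 ≤ δ) (x : ℝ) : lineTrace σ δ (oscCauchy k f) x =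
      𝓕⁻ (cauchyDensity k σ δ (fourierL2 f hf.1)) x := by
  unfold lineTrace
  split_ifs with h
  · subst h; exact boundaryValue_oscCauchy hf k σ x
  · exact oscCauchy_eq_fourierInv hf.1 k σ (lt_of_le_of_ne hδ (Ne.symm h)) x


/-! ### The error on horizontal lines -/

theorem cauchyDensity_congr {u v : ℝ → ℂ} (h : u =ᵐ[volume] v) (k : ℝ) (σ : ℤˣ) (δ : ℝ) :
    cauchyDensity k σ δ u =ᵐ[volume] cauchyDensity k σ δ v := by
  filter_upwards [(measurePreserving_add_right volume
    (k / (2 * Real.pi))).quasiMeasurePreserving.ae_eq_comp h] with t ht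
  simp only [Function.comp_apply] at ht
  simp only [cauchyDensity, ht]

theorem eLpNorm_cauchyDensity_le {v : ℝ → ℂ} (hv : AEStronglyMeasurable v) (k : ℝ)
    (σ : ℤˣ) {δ : ℝ} (hδ : 0 ≤ δ) : eLpNorm (cauchyDensity k σ δ v) 2 volume ≤ eLpNorm v 2 volume := by
  rw [← eLpNorm_comp_measurePreserving hv
    (measurePreserving_add_right volume (k / (2 * Real.pi)))]
  refine eLpNorm_mono fun t => ?_
  rw [cauchyDensity, norm_mul]
  exact mul_le_of_le_one_left (norm_nonneg _) (norm_cauchyMultiplier_le_one σ hδ t)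

theorem eLpNorm_sobolevWeight_cauchyDensity_le {v : ℝ → ℂ} (hv : AEStronglyMeasurable v) (k : ℝ)
    (σ : ℤˣ) {δ : ℝ} (hδ : 0 ≤ δ) :
    eLpNorm (sobolevWeight (cauchyDensity k σ δ v)) 2 volume ≤
      ENNReal.ofReal (1 + |k|) * eLpNorm (sobolevWeight v) 2 volume := by
  have h0 : 0 ≤ 1 + |k| := by positivity
  rw [← eLpNorm_comp_measurePreserving (aestronglyMeasurable_sobolevWeight hv)
    (measurePreserving_add_right volume k)]
  have e : ENNReal.ofReal (1 + |k|) = ‖((1 + |k| : ℝ) : ℂ)‖ₑ := by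
    rw [← ofReal_norm, Complex.norm_real, Real.norm_of_nonneg h0]
  rw [e, ← eLpNorm_const_smul]
  refine eLpNorm_mono fun ξ => ?_
  have h1 : 0 ≤ 1 + |ξ| := by positivity
  have h2 : 0 ≤ 1 + |ξ + k| := by positivity
  simp only [sobolevWeight, cauchyDensity, Pi.smul_apply, Function.comp_apply, smul_eq_mul,
    norm_mul, Complex.norm_real, Real.norm_of_nonneg h0, Real.norm_of_nonneg h1,
    Real.norm_of_nonneg h2, ← add_div]
  have h3 := norm_cauchyMultiplier_le_one σ hδ (ξ / (2 * Real.pi))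
  -- Submultiplicativity of the weight is the only source of the factor `1 + |k|`.
  have h4 : 1 + |ξ| ≤ (1 + |k|) * (1 + |ξ + k|) := by
    have : |ξ| ≤ |ξ + k| + |k| := by
      calc |ξ| = |(ξ + k) - k| := by ring_nf
        _ ≤ _ := abs_sub _ _
    nlinarith [abs_nonneg k, abs_nonneg (ξ + k)]
  calc _ ≤ (1 + |ξ|) * (1 * ‖v ((ξ + k) / (2 * Real.pi))‖) := by gcongr
    _ ≤ ((1 + |k|) * (1 + |ξ + k|)) * ‖v ((ξ + k) / (2 * Real.pi))‖ := by
      rw [one_mul]; gcongr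
    _ = _ := by ring

variable {f R : ℝ → ℂ} (hf : MemSobolevLine 1 f) (hR : MemSobolevLine 1 R)
  (hg : MemLp (fun x => R x - f x) 2 volume)

include hf hR in
theorem integrable_fourierL2_sub : Integrable (fourierL2 (fun x => R x - f x) hg) :=
  (hR.integrable_fourierL2.sub hf.integrable_fourierL2).congr (fourierL2_sub hR.1 hf.1 hg).symm

include hf hR in
-- By linearity the error is the Cauchy integral of `f - R`; the minus sign arises because `hg`
-- concerns `R - f`.
theorem lineTrace_sub_eq_fourierInv (k : ℝ) (σ : ℤˣ) {δ : ℝ} (hδ : 0 ≤ δ) :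
    (fun x => lineTrace σ δ (oscCauchy k f) x - lineTrace σ δ (oscCauchy k R) x) =
      𝓕⁻ (cauchyDensity k σ δ fun t => -fourierL2 (fun x => R x - f x) hg t) := by
  ext x
  rw [lineTrace_oscCauchy hf k σ hδ, lineTrace_oscCauchy hR k σ hδ]
  simp only [Real.fourierInv_eq]
  have hi : ∀ v : ℝ → ℂ, Integrable v →
      Integrable fun t : ℝ => Real.fourierChar (inner ℝ t x) • cauchyDensity k σ δ v t :=
    fun v hv => by
      have := (Real.fourierIntegral_convergent_iff (μ := volume) (-x)).mpr
        (integrable_cauchyDensity hv k σ hδ)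
      simpa using this
  rw [← integral_sub (hi _ hf.integrable_fourierL2) (hi _ hR.integrable_fourierL2)]
  refine integral_congr_ae ?_
  have h1 : (fun t => fourierL2 f hf.1 t - fourierL2 R hR.1 t) =ᵐ[volume]
      fun t => -fourierL2 (fun x => R x - f x) hg t := by
    filter_upwards [fourierL2_sub hR.1 hf.1 hg] with t ht
    rw [ht]; ring
  filter_upwards [cauchyDensity_congr h1 k σ δ] with t ht
  rw [← ht, ← smul_sub]
  simp only [cauchyDensity]
  rw [mul_sub]

include hf hR hg in
-- Each bound is a comparison of densities: modulus of the multiplier at most one for `L²`, the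
-- shifted weight for `H¹`, and for the supremum monotonicity in `δ` followed by the embedding of
-- weighted `L²` into `L¹`.
theorem sobolevNorm_lineTrace_sub_le (k : ℝ) (σ : ℤˣ) {δ : ℝ} (hδ : 0 ≤ δ) :
    sobolevNorm 1
        (fun x => lineTrace σ δ (oscCauchy k f) x - lineTrace σ δ (oscCauchy k R) x) ≤
      ENNReal.ofReal (1 + |k|) * sobolevNorm 1 (fun x => R x - f x) ∧
    eLpNorm (fun x => lineTrace σ δ (oscCauchy k f) x - lineTrace σ δ (oscCauchy k R) x) 2 volume ≤
      eLpNorm (fun x => R x - f x) 2 volume ∧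
    (⨆ x, ‖lineTrace σ δ (oscCauchy k f) x - lineTrace σ δ (oscCauchy k R) x‖ₑ) ≤
      sobolevNorm 1
        (fun x => lineTrace σ 0 (oscCauchy k f) x - lineTrace σ 0 (oscCauchy k R) x) := by
  set v := fourierL2 (fun x => R x - f x) hg with hv
  have hvi : Integrable fun t => -v t := (integrable_fourierL2_sub hf hR hg).neg
  have hvm : MemLp (fun t => -v t) 2 volume := (memLp_fourierL2 _ hg).neg
  have hw1 : ∀ {δ : ℝ}, 0 ≤ δ → Integrable (cauchyDensity k σ δ fun t => -v t) := fun hδ =>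
    integrable_cauchyDensity hvi k σ hδ
  have hw2 : ∀ {δ : ℝ}, 0 ≤ δ → MemLp (cauchyDensity k σ δ fun t => -v t) 2 volume := fun hδ =>
    ⟨(hw1 hδ).1, (eLpNorm_cauchyDensity_le hvm.1 k σ hδ).trans_lt hvm.2⟩
  have hs : ∀ {δ : ℝ}, 0 ≤ δ → sobolevNorm 1
        (fun x => lineTrace σ δ (oscCauchy k f) x - lineTrace σ δ (oscCauchy k R) x) =
      eLpNorm (sobolevWeight (cauchyDensity k σ δ fun t => -v t)) 2 volume := fun {δ} hδ => by
    rw [lineTrace_sub_eq_fourierInv hf hR hg k σ hδ,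
      sobolevNorm_one_eq _ (memLp_fourierInv (hw1 hδ) (hw2 hδ))]
    exact eLpNorm_congr_ae (sobolevWeight_congr (fourierL2_fourierInv (hw1 hδ) (hw2 hδ) _))
  refine ⟨?_, ?_, ?_⟩
  · rw [hs hδ, sobolevNorm_one_eq _ hg]
    refine (eLpNorm_sobolevWeight_cauchyDensity_le hvm.1 k σ hδ).trans (le_of_eq ?_)
    congr 1
    refine eLpNorm_congr_norm_ae (ae_of_all _ fun ξ => ?_)
    simp [sobolevWeight, hv]
  · rw [lineTrace_sub_eq_fourierInv hf hR hg k σ hδ, ← eLpNorm_fourierL2 _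
      (memLp_fourierInv (hw1 hδ) (hw2 hδ)), eLpNorm_congr_ae
      (fourierL2_fourierInv (hw1 hδ) (hw2 hδ) _)]
    refine (eLpNorm_cauchyDensity_le hvm.1 k σ hδ).trans (le_of_eq ?_)
    rw [← eLpNorm_fourierL2 _ hg]
    exact eLpNorm_neg (f := v) (p := 2) (μ := volume)
  · refine iSup_le fun x => ?_
    rw [hs le_rfl, congrFun (lineTrace_sub_eq_fourierInv hf hR hg k σ hδ) x, Real.fourierInv_eq]
    refine (enorm_integral_le_lintegral_enorm _).trans ?_
    refine le_trans (lintegral_mono fun t => ?_)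
      (lintegral_enorm_le_sobolevWeight (hw1 (le_refl (0 : ℝ))).1)
    rw [enorm_le_iff_norm_le, Circle.norm_smul, cauchyDensity, cauchyDensity, norm_mul, norm_mul]
    gcongr
    exact norm_cauchyMultiplier_le_zero σ hδ t

/-- Continuous functions in `H¹(ℝ)` vanish at infinity. -/
theorem MemSobolevLine.tendsto_cocompact {f : ℝ → ℂ} (hf : MemSobolevLine 1 f)
    (hc : Continuous f) : Tendsto f (cocompact ℝ) (𝓝 0) := by
  rw [eq_fourierInv_fourierL2 hc hf.1 hf.integrable_fourierL2]
  -- Riemann–Lebesgue, available since the transform of `f` is integrable.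
  have h1 := Real.zero_at_infty_fourier (fourierL2 f hf.1)
  have h2 : (𝓕⁻ (fourierL2 f hf.1) : ℝ → ℂ) = 𝓕 (fourierL2 f hf.1) ∘ fun x => -x := by
    ext x; rw [Real.fourierInv_eq_fourier_neg]; rfl
  rw [h2]
  exact h1.comp (Homeomorph.neg ℝ).isClosedEmbedding.tendsto_cocompact


/-! ### Powers of the Möbius transformation on the line -/

/-- The Poisson density `2β / (x² + β²)`, which is the derivative of the argument of `M_β`. -/
def moebiusDensity (β x : ℝ) : ℝ := 2 * β / (x ^ 2 + β ^ 2)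

section

variable {β : ℝ} (hβ : 0 < β)
include hβ

theorem ofReal_add_I_mul_ne_zero (x : ℝ) : (x : ℂ) + I * β ≠ 0 := fun h => by
  have := congrArg Complex.im h
  simp at this
  exact hβ.ne' this

theorem ofReal_sub_I_mul_ne_zero (x : ℝ) : (x : ℂ) - I * β ≠ 0 := fun h => by
  have := congrArg Complex.im h
  simp at this
  exact hβ.ne' this

theorem moebius_ne_zero (x : ℝ) : moebius β x ≠ 0 :=
  div_ne_zero (ofReal_sub_I_mul_ne_zero hβ x) (ofReal_add_I_mul_ne_zero hβ x)

theorem norm_moebius (x : ℝ) : ‖moebius β x‖ = 1 := by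
  have h : (x : ℂ) - I * β = (starRingEnd ℂ) (x + I * β) := by simp [sub_eq_add_neg]
  rw [moebius, norm_div, h, RCLike.norm_conj, div_self]
  exact norm_ne_zero_iff.mpr (ofReal_add_I_mul_ne_zero hβ x)

theorem norm_moebius_zpow (x : ℝ) (j : ℤ) : ‖moebius β x ^ j‖ = 1 := by
  rw [norm_zpow, norm_moebius hβ, one_zpow]

theorem moebius_sub_one (x : ℝ) : moebius β x - 1 = -(2 * I * β) / (x + I * β) := by
  have := ofReal_add_I_mul_ne_zero hβ x
  rw [moebius]; field_simp; ring

theorem moebius_ne_one (x : ℝ) : moebius β x ≠ 1 := fun h => by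
  have h1 := moebius_sub_one hβ x
  rw [h, sub_self] at h1
  have h2 : -(2 * I * β : ℂ) ≠ 0 := by
    have : (β : ℂ) ≠ 0 := by exact_mod_cast hβ.ne'
    simp [this]
  exact div_ne_zero h2 (ofReal_add_I_mul_ne_zero hβ x) h1.symm

theorem hasDerivAt_moebius_zpow (j : ℤ) (x : ℝ) :
    HasDerivAt (fun x : ℝ => moebius β x ^ j)
      (I * j * moebiusDensity β x * moebius β x ^ j) x := by
  have hp := ofReal_add_I_mul_ne_zero hβ x
  have hm := ofReal_sub_I_mul_ne_zero hβ x
  have h1 : HasDerivAt (fun x : ℝ => moebius β x)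
      ((1 * (x + I * β) - (x - I * β) * 1) / (x + I * β) ^ 2) x :=
    ((Complex.ofRealCLM.hasDerivAt).sub_const _).div
      ((Complex.ofRealCLM.hasDerivAt).add_const _) hp
  have h2 := (hasDerivAt_zpow j (moebius β x) (Or.inl (moebius_ne_zero hβ x))).comp x h1
  refine h2.congr_deriv ?_
  rw [zpow_sub_one₀ (moebius_ne_zero hβ x)]
  have h3 : ((x ^ 2 + β ^ 2 : ℝ) : ℂ) = (x + I * β) * (x - I * β) := by
    push_cast; ring_nf; rw [I_sq]; ring
  have h4 : (moebiusDensity β x : ℂ) = 2 * β / ((x + I * β) * (x - I * β)) := by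
    rw [← h3, moebiusDensity]; push_cast; ring
  rw [h4]
  generalize moebius β x ^ j = y
  rw [moebius]
  field_simp
  ring

theorem continuous_moebius_zpow (j : ℤ) : Continuous fun x : ℝ => moebius β x ^ j :=
  continuous_iff_continuousAt.mpr fun x => (hasDerivAt_moebius_zpow hβ j x).continuousAt

theorem sq_add_sq_pos (x : ℝ) : 0 < x ^ 2 + β ^ 2 := by positivity

theorem moebiusDensity_pos (x : ℝ) : 0 < moebiusDensity β x :=
  div_pos (by positivity) (sq_add_sq_pos hβ x)

theorem moebiusDensity_le (x : ℝ) : moebiusDensity β x ≤ 2 / β := by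
  rw [moebiusDensity, div_le_div_iff₀ (sq_add_sq_pos hβ x) hβ]
  nlinarith [sq_nonneg x]

theorem continuous_moebiusDensity : Continuous (moebiusDensity β) :=
  continuous_const.div (by fun_prop) fun x => (sq_add_sq_pos hβ x).ne'

theorem inv_sq_add_sq_eq (x : ℝ) : (x ^ 2 + β ^ 2)⁻¹ = (β ^ 2)⁻¹ * (1 + (x / β) ^ 2)⁻¹ := by
  have := sq_add_sq_pos hβ x
  field_simp
  rw [add_comm]

theorem integrable_inv_sq_add_sq : Integrable fun x : ℝ => (x ^ 2 + β ^ 2)⁻¹ := by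
  simp_rw [inv_sq_add_sq_eq hβ]
  exact (integrable_inv_one_add_sq.comp_div hβ.ne').const_mul _

theorem integral_inv_sq_add_sq : ∫ x : ℝ, (x ^ 2 + β ^ 2)⁻¹ = Real.pi / β := by
  simp_rw [inv_sq_add_sq_eq hβ]
  rw [integral_const_mul, Measure.integral_comp_div (fun x => (1 + x ^ 2)⁻¹) β,
    integral_univ_inv_one_add_sq, abs_of_pos hβ, smul_eq_mul]
  field_simp

theorem integrable_moebiusDensity : Integrable (moebiusDensity β) :=
  (integrable_inv_sq_add_sq hβ).const_mul (2 * β)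

theorem integral_moebiusDensity : ∫ x, moebiusDensity β x = 2 * Real.pi := by
  have : ∀ x, moebiusDensity β x = 2 * β * (x ^ 2 + β ^ 2)⁻¹ := fun x => rfl
  simp_rw [this]
  rw [integral_const_mul, integral_inv_sq_add_sq hβ]
  field_simp

theorem norm_moebius_sub_one (x : ℝ) :
    ‖moebius β x - 1‖ = 2 * β / ‖(x : ℂ) + I * β‖ := by
  rw [moebius_sub_one hβ, norm_div]
  simp [abs_of_pos hβ]

omit hβ in
theorem abs_le_norm_add_I_mul (x : ℝ) : |x| ≤ ‖(x : ℂ) + I * β‖ := by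
  have := Complex.abs_re_le_norm ((x : ℂ) + I * β)
  simpa using this

theorem tendsto_moebius_cocompact : Tendsto (fun x : ℝ => moebius β x) (cocompact ℝ) (𝓝 1) := by
  rw [tendsto_iff_norm_sub_tendsto_zero]
  simp_rw [norm_moebius_sub_one hβ]
  exact tendsto_const_nhds.div_atTop
    (tendsto_atTop_mono abs_le_norm_add_I_mul tendsto_norm_cocompact_atTop)

theorem integrable_density_mul_zpow (j : ℤ) :
    Integrable fun x : ℝ => (moebiusDensity β x : ℂ) * moebius β x ^ j := by
  refine (integrable_moebiusDensity hβ).mono' ?_ (ae_of_all _ fun x => ?_)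
  · exact ((Complex.continuous_ofReal.comp (continuous_moebiusDensity hβ)).mul
      (continuous_moebius_zpow hβ j)).aestronglyMeasurable
  · rw [norm_mul, norm_moebius_zpow hβ, mul_one, Complex.norm_real,
      Real.norm_of_nonneg (moebiusDensity_pos hβ x).le]

/-- Orthogonality of the powers of `M_β` for the density `2β / (x² + β²)`. -/
theorem integral_density_mul_zpow (j : ℤ) :
    ∫ x : ℝ, (moebiusDensity β x : ℂ) * moebius β x ^ j = if j = 0 then 2 * Real.pi else 0 := by
  split_ifs with h
  · subst h
    simp only [zpow_zero, mul_one]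
    rw [integral_complex_ofReal, integral_moebiusDensity hβ]
  · have hj : (I * j : ℂ) ≠ 0 := mul_ne_zero I_ne_zero (by exact_mod_cast h)
    -- The antiderivative `M^j / (ij)` has the same limit at both ends of the line because `M` tends
    -- to `1` at each of them.
    have hl : Tendsto (fun x : ℝ => (I * j : ℂ)⁻¹ * moebius β x ^ j) (cocompact ℝ)
        (𝓝 ((I * j : ℂ)⁻¹ * 1 ^ j)) :=
      ((tendsto_moebius_cocompact hβ).zpow₀ j (Or.inl one_ne_zero)).const_mul _
    have := integral_of_hasDerivAt_of_tendsto (f := fun x : ℝ => (I * j : ℂ)⁻¹ * moebius β x ^ j)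
      (f' := fun x : ℝ => (moebiusDensity β x : ℂ) * moebius β x ^ j) (fun x => ?_)
      (integrable_density_mul_zpow hβ j) (hl.mono_left atBot_le_cocompact)
      (hl.mono_left atTop_le_cocompact)
    · rw [this, sub_self, ofReal_zero]
    · refine ((hasDerivAt_moebius_zpow hβ j x).const_mul _).congr_deriv ?_
      field_simp

theorem norm_moebius_zpow_sub_one_le (j : ℤ) (x : ℝ) :
    ‖moebius β x ^ j - 1‖ ≤ |(j : ℝ)| * ‖moebius β x - 1‖ := by
  have hnat : ∀ m : ℕ, ‖moebius β x ^ m - 1‖ ≤ m * ‖moebius β x - 1‖ := fun m => by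
    induction m with
    | zero => simp
    | succ m ih =>
      have : moebius β x ^ (m + 1) - 1 =
          moebius β x * (moebius β x ^ m - 1) + (moebius β x - 1) := by ring
      rw [this]
      refine (norm_add_le _ _).trans ?_
      rw [norm_mul, norm_moebius hβ]
      push_cast
      linarith
  obtain ⟨m, rfl | rfl⟩ := j.eq_nat_or_neg
  · simpa using hnat m
  · have h0 := moebius_ne_zero hβ x
    have : moebius β x ^ (-(m : ℤ)) - 1 = -(moebius β x ^ (-(m : ℤ)) * (moebius β x ^ m - 1)) := by
      rw [mul_sub, zpow_neg, zpow_natCast, inv_mul_cancel₀ (pow_ne_zero _ h0)]; ring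
    rw [this, norm_neg, norm_mul, norm_moebius_zpow hβ]
    simpa using hnat m

/-- With `N` the modulus of the difference and `A = β|a - b|`, there are two bounds: `N ≤ 2`
trivially, and `N|x| ≤ 2A` from the distance of `M` to `1`. Squaring gives `N²(x² + A²) ≤ 8A²`. -/
theorem norm_sq_zpow_sub_zpow_le (a b : ℤ) (hab : a ≠ b) (x : ℝ) :
    ‖moebius β x ^ a - moebius β x ^ b‖ ^ 2 ≤
      8 * (β * |((a - b : ℤ) : ℝ)|) ^ 2 * (x ^ 2 + (β * |((a - b : ℤ) : ℝ)|) ^ 2)⁻¹ := by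
  set A := β * |((a - b : ℤ) : ℝ)| with hA
  have hm : (0 : ℝ) < |((a - b : ℤ) : ℝ)| := abs_pos.mpr (by exact_mod_cast sub_ne_zero.mpr hab)
  have hA0 : 0 < A := by positivity
  have e : moebius β x ^ a - moebius β x ^ b = moebius β x ^ b * (moebius β x ^ (a - b) - 1) := by
    rw [mul_sub, ← zpow_add₀ (moebius_ne_zero hβ x)]; simp
  rw [e, norm_mul, norm_moebius_zpow hβ, one_mul, ← div_eq_mul_inv, le_div_iff₀ (by positivity)]
  set N := ‖moebius β x ^ (a - b) - 1‖ with hN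
  have h1 : N ≤ 2 := by
    refine (norm_sub_le _ _).trans ?_
    rw [norm_moebius_zpow hβ, norm_one]; norm_num
  have h2 : N * |x| ≤ 2 * A := by
    have h3 := norm_moebius_zpow_sub_one_le hβ (a - b) x
    have h4 : ‖moebius β x - 1‖ * |x| ≤ 2 * β := by
      rw [norm_moebius_sub_one hβ, div_mul_eq_mul_div,
        div_le_iff₀ (norm_pos_iff.mpr (ofReal_add_I_mul_ne_zero hβ x))]
      exact mul_le_mul_of_nonneg_left (abs_le_norm_add_I_mul x) (by positivity)
    calc N * |x| ≤ (|((a - b : ℤ) : ℝ)| * ‖moebius β x - 1‖) * |x| := by gcongr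
      _ = |((a - b : ℤ) : ℝ)| * (‖moebius β x - 1‖ * |x|) := by ring
      _ ≤ |((a - b : ℤ) : ℝ)| * (2 * β) := by gcongr
      _ = 2 * A := by rw [hA]; ring
  have h0 : 0 ≤ N := norm_nonneg _
  have h5 : N ^ 2 * x ^ 2 ≤ 4 * A ^ 2 := by
    have := pow_le_pow_left₀ (by positivity) h2 2
    rw [mul_pow, sq_abs] at this
    linarith
  have h6 : N ^ 2 ≤ 4 := by nlinarith
  nlinarith [mul_le_mul_of_nonneg_right h6 (sq_nonneg A)]

/-- Integrating the pointwise bound gives `8A² · π/A = 8πA`. The growth is only the square root of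
`|a - b|`, which is what leaves the exponent `1 + ε - s` after Cauchy–Schwarz. -/
theorem eLpNorm_zpow_sub_zpow_le (a b : ℤ) :
    eLpNorm (fun x : ℝ => moebius β x ^ a - moebius β x ^ b) 2 volume ≤
      ENNReal.ofReal (√(8 * Real.pi * β * |((a - b : ℤ) : ℝ)|)) := by
  by_cases hab : a = b
  · subst hab; simp
  rw [eLpNorm_eq_lintegral_rpow_enorm_toReal two_ne_zero ENNReal.ofNat_ne_top]
  simp only [ENNReal.toReal_ofNat]
  set A := β * |((a - b : ℤ) : ℝ)| with hA
  have hm : (0 : ℝ) < |((a - b : ℤ) : ℝ)| := abs_pos.mpr (by exact_mod_cast sub_ne_zero.mpr hab)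
  have hA0 : 0 < A := by positivity
  have h1 : ∫⁻ x : ℝ, ‖moebius β x ^ a - moebius β x ^ b‖ₑ ^ (2 : ℝ) ≤
      ENNReal.ofReal (8 * Real.pi * β * |((a - b : ℤ) : ℝ)|) := by
    have e : 8 * Real.pi * β * |((a - b : ℤ) : ℝ)| =
        ∫ x : ℝ, 8 * A ^ 2 * (x ^ 2 + A ^ 2)⁻¹ := by
      rw [integral_const_mul, integral_inv_sq_add_sq hA0]
      field_simp; rw [hA]
    rw [e, ofReal_integral_eq_lintegral_ofReal ((integrable_inv_sq_add_sq hA0).const_mul _)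
      (ae_of_all _ fun x => by positivity)]
    refine lintegral_mono fun x => ?_
    rw [ENNReal.rpow_ofNat, ← ofReal_norm, ← ENNReal.ofReal_pow (norm_nonneg _)]
    exact ENNReal.ofReal_le_ofReal (norm_sq_zpow_sub_zpow_le hβ a b hab x)
  rw [Real.sqrt_eq_rpow, ← ENNReal.ofReal_rpow_of_pos (by positivity)]
  gcongr

/-- Parseval on the circle, transported to the line: the double sum collapses to its diagonal by
orthogonality. -/
theorem integral_density_mul_norm_sq (s : Finset ℤ) (c : ℤ → ℂ) :
    Integrable (fun x : ℝ => moebiusDensity β x * ‖∑ i ∈ s, c i * moebius β x ^ i‖ ^ 2) ∧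
    ∫ x : ℝ, moebiusDensity β x * ‖∑ i ∈ s, c i * moebius β x ^ i‖ ^ 2 =
      2 * Real.pi * ∑ i ∈ s, ‖c i‖ ^ 2 := by
  have hconj : ∀ (x : ℝ) (i : ℤ), (starRingEnd ℂ) (moebius β x ^ i) = moebius β x ^ (-i) :=
    fun x i => by
      rw [zpow_neg, Complex.inv_def, Complex.normSq_eq_norm_sq, norm_moebius_zpow hβ]; simp
  have e : ∀ x : ℝ, ((moebiusDensity β x * ‖∑ i ∈ s, c i * moebius β x ^ i‖ ^ 2 : ℝ) : ℂ) =
      ∑ i ∈ s, ∑ l ∈ s, c i * (starRingEnd ℂ) (c l) *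
        ((moebiusDensity β x : ℂ) * moebius β x ^ (i - l)) := fun x => by
    push_cast
    rw [← Complex.mul_conj', map_sum, Finset.sum_mul_sum, Finset.mul_sum]
    refine Finset.sum_congr rfl fun i _ => ?_
    rw [Finset.mul_sum]
    refine Finset.sum_congr rfl fun l _ => ?_
    rw [map_mul, hconj, sub_eq_add_neg, zpow_add₀ (moebius_ne_zero hβ x)]
    ring
  have hint : ∀ i l : ℤ, Integrable fun x : ℝ => c i * (starRingEnd ℂ) (c l) *
        ((moebiusDensity β x : ℂ) * moebius β x ^ (i - l)) := fun i l =>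
    (integrable_density_mul_zpow hβ (i - l)).const_mul _
  have hI : Integrable fun x : ℝ =>
      ((moebiusDensity β x * ‖∑ i ∈ s, c i * moebius β x ^ i‖ ^ 2 : ℝ) : ℂ) := by
    simp_rw [e]
    exact integrable_finsetSum _ fun i _ => integrable_finsetSum _ fun l _ => hint i l
  refine ⟨by simpa only [RCLike.re_to_complex, ofReal_re] using hI.re, ?_⟩
  rw [← Complex.ofReal_inj, ← integral_complex_ofReal]
  simp_rw [e]
  rw [integral_finsetSum _ fun i _ => integrable_finsetSum _ fun l _ => hint i l]
  push_cast
  rw [Finset.mul_sum]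
  refine Finset.sum_congr rfl fun i hi => ?_
  rw [integral_finsetSum _ fun l _ => hint i l]
  simp_rw [integral_const_mul, integral_density_mul_zpow hβ, sub_eq_zero]
  rw [Finset.sum_eq_single i]
  · simp only [if_true]; rw [Complex.mul_conj']; push_cast; ring
  · intro l _ hl; simp [Ne.symm hl]
  · intro h; exact absurd hi h

/-- The unweighted `L²` norm involves `ρ²`; bounding one factor by `2/β` leaves the orthogonality
weight `ρ`. -/
theorem eLpNorm_density_mul_sum_le (s : Finset ℤ) (c : ℤ → ℂ) :
    eLpNorm (fun x : ℝ => (moebiusDensity β x : ℂ) * ∑ i ∈ s, c i * moebius β x ^ i) 2 volume ≤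
      ENNReal.ofReal (√(4 * Real.pi / β * ∑ i ∈ s, ‖c i‖ ^ 2)) := by
  obtain ⟨hI, hE⟩ := integral_density_mul_norm_sq hβ s c
  rw [eLpNorm_eq_lintegral_rpow_enorm_toReal two_ne_zero ENNReal.ofNat_ne_top]
  simp only [ENNReal.toReal_ofNat]
  rw [Real.sqrt_eq_rpow, ← ENNReal.ofReal_rpow_of_nonneg (by positivity) (by norm_num)]
  gcongr
  have e : 4 * Real.pi / β * ∑ i ∈ s, ‖c i‖ ^ 2 = ∫ x : ℝ, 2 / β *
      (moebiusDensity β x * ‖∑ i ∈ s, c i * moebius β x ^ i‖ ^ 2) := by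
    rw [integral_const_mul, hE]; ring
  have hnn := fun x => (moebiusDensity_pos hβ x).le
  rw [e, ofReal_integral_eq_lintegral_ofReal (hI.const_mul _)
    (ae_of_all _ fun x => mul_nonneg (by positivity) (mul_nonneg (hnn x) (by positivity)))]
  refine lintegral_mono fun x => ?_
  rw [ENNReal.rpow_ofNat, ← ofReal_norm, ← ENNReal.ofReal_pow (norm_nonneg _)]
  refine ENNReal.ofReal_le_ofReal ?_
  rw [norm_mul, mul_pow, Complex.norm_real, Real.norm_of_nonneg (hnn x), sq (moebiusDensity β x),
    mul_assoc]
  exact mul_le_mul_of_nonneg_right (moebiusDensity_le hβ x)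
    (mul_nonneg (hnn x) (by positivity))

end


/-! ### Fourier expansion of the pullback -/

theorem moebiusInv_moebius {β : ℝ} (hβ : 0 < β) (x : ℝ) : moebiusInv β (moebius β x) = x := by
  have hp := ofReal_add_I_mul_ne_zero hβ x
  have hb : (β : ℂ) ≠ 0 := by exact_mod_cast hβ.ne'
  have h1 : moebius β x + 1 = 2 * x / (x + I * β) := by rw [moebius]; field_simp; ring
  rw [moebiusInv, moebius_sub_one hβ, h1]
  have hI := I_ne_zero
  rw [div_div_div_cancel_right₀ hp]
  field_simp
  rw [I_sq]; ring

theorem lineParam_eq {β : ℝ} (hβ : 0 < β) {x θ : ℝ} (h : exp (θ * I) = moebius β x) :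
    lineParam β θ = x := by
  rw [lineParam, h, moebiusInv_moebius hβ, ofReal_re]

theorem pullback_eq {β : ℝ} (hβ : 0 < β) (f : ℝ → ℂ) {x θ : ℝ} (h : exp (θ * I) = moebius β x) :
    pullback β f θ = f x := by
  rw [pullback, if_neg (h ▸ moebius_ne_one hβ x), lineParam_eq hβ h]

theorem pullback_congr_of_exp_eq (β : ℝ) (f : ℝ → ℂ) {θ θ' : ℝ} (h : exp (θ * I) = exp (θ' * I)) :
    pullback β f θ = pullback β f θ' := by
  simp only [pullback, lineParam, h]

theorem exists_exp_eq_moebius {β : ℝ} (hβ : 0 < β) (x : ℝ) :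
    ∃ θ : ℝ, exp (θ * I) = moebius β x :=
  ⟨arg (moebius β x), by
    have := Complex.norm_mul_exp_arg_mul_I (moebius β x)
    rwa [norm_moebius hβ, ofReal_one, one_mul] at this⟩

/-- Only the points with `e^{iθ} = 1` need care. There the neighbourhood filter is split: on the set
where `e^{iφ} = 1` the value is zero by definition, and off it `|T(φ)| = β|e^{iφ} + 1| / |e^{iφ} -
1|` tends to infinity, where `f` vanishes. -/
theorem continuous_pullback {β : ℝ} (hβ : 0 < β) {f : ℝ → ℂ} (hc : Continuous f)
    (h0 : Tendsto f (cocompact ℝ) (𝓝 0)) : Continuous (pullback β f) := by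
  have hE : Continuous fun θ : ℝ => exp (θ * I) := by fun_prop
  rw [continuous_iff_continuousAt]
  intro θ
  by_cases h : exp (θ * I) = 1
  · have hv : pullback β f θ = 0 := if_pos h
    rw [ContinuousAt, hv]
    set s : Set ℝ := {φ | exp (φ * I) = 1} with hs
    have h1 : Tendsto (pullback β f) (𝓝[s] θ) (𝓝 0) :=
      tendsto_const_nhds.congr' (by
        filter_upwards [self_mem_nhdsWithin] with φ hφ
        exact (if_pos hφ).symm)
    have h2 : Tendsto (pullback β f) (𝓝[sᶜ] θ) (𝓝 0) := by
      have hlp : Tendsto (lineParam β) (𝓝[sᶜ] θ) (cocompact ℝ) := by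
        rw [← Metric.cobounded_eq_cocompact, ← comap_norm_atTop, tendsto_comap_iff]
        simp only [Function.comp_def]
        have e : ∀ φ : ℝ, ‖lineParam β φ‖ = β * (‖exp (φ * I) + 1‖ / ‖exp (φ * I) - 1‖) :=
          fun φ => by
            have h3 : ((lineParam β φ : ℝ) : ℂ) = moebiusInv β (exp (φ * I)) :=
              Complex.ext (by simp [lineParam]) (by simp [moebiusInv_exp_im])
            rw [← Complex.norm_real, h3, moebiusInv]
            simp [abs_of_pos hβ]
        simp_rw [e]
        refine Tendsto.const_mul_atTop hβ ?_
        have hn : Tendsto (fun φ : ℝ => ‖exp (φ * I) + 1‖) (𝓝[sᶜ] θ) (𝓝 ‖exp (θ * I) + 1‖) :=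
          ((by fun_prop : Continuous fun φ : ℝ => ‖exp (φ * I) + 1‖).tendsto θ).mono_left
            nhdsWithin_le_nhds
        have hd : Tendsto (fun φ : ℝ => ‖exp (φ * I) - 1‖) (𝓝[sᶜ] θ) (𝓝[>] 0) := by
          refine tendsto_nhdsWithin_iff.mpr ⟨?_, ?_⟩
          · have := ((by fun_prop : Continuous fun φ : ℝ => ‖exp (φ * I) - 1‖).tendsto θ).mono_left
              (nhdsWithin_le_nhds (s := sᶜ))
            rwa [h, sub_self, norm_zero] at this
          · filter_upwards [self_mem_nhdsWithin] with φ hφ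
            exact norm_pos_iff.mpr (sub_ne_zero.mpr hφ)
        have hpos : 0 < ‖exp (θ * I) + 1‖ := by rw [h]; norm_num
        simp_rw [div_eq_mul_inv]
        exact hn.pos_mul_atTop hpos hd.inv_tendsto_nhdsGT_zero
      refine (h0.comp hlp).congr' ?_
      filter_upwards [self_mem_nhdsWithin] with φ hφ
      exact (if_neg hφ).symm
    have := h1.sup h2
    rwa [← nhdsWithin_union, Set.union_compl_self, nhdsWithin_univ] at this
  · have h1 : ContinuousAt (fun φ => f (lineParam β φ)) θ := by
      refine hc.continuousAt.comp ?_
      unfold lineParam moebiusInv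
      refine Complex.continuous_re.continuousAt.comp ?_
      refine ContinuousAt.mul continuousAt_const (ContinuousAt.div ?_ ?_ (sub_ne_zero.mpr h))
      · fun_prop
      · fun_prop
    refine h1.congr ?_
    filter_upwards [hE.continuousAt.eventually_ne h] with φ hφ
    exact (if_neg hφ).symm

/-- `F` is continuous with equal values at `0` and `2π`, so it descends to the circle, where
summable coefficients give pointwise convergence of the Fourier series. -/
theorem hasSum_pullback {β : ℝ} (hβ : 0 < β) {f : ℝ → ℂ} (hc : Continuous f)
    (h0 : Tendsto f (cocompact ℝ) (𝓝 0)) (hs : Summable (periodicCoeff (pullback β f))) (θ : ℝ) :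
    HasSum (fun j : ℤ => periodicCoeff (pullback β f) j * exp (θ * I) ^ j) (pullback β f θ) := by
  have : Fact (0 < 2 * Real.pi) := ⟨Real.two_pi_pos⟩
  have hF := continuous_pullback hβ hc h0
  have hper : pullback β f 0 = pullback β f (2 * Real.pi) :=
    pullback_congr_of_exp_eq β f (by push_cast; rw [Complex.exp_two_pi_mul_I]; simp)
  let G : C(AddCircle (2 * Real.pi), ℂ) :=
    ⟨AddCircle.liftIoc (2 * Real.pi) 0 (pullback β f),
      AddCircle.liftIoc_zero_continuous hper hF.continuousOn⟩
  have hcoeff : fourierCoeff G = periodicCoeff (pullback β f) := by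
    ext j
    have h1 := fourierCoeff_liftIoc_eq (T := 2 * Real.pi) (a := 0) (pullback β f) j
    refine h1.trans ?_
    rw [periodicCoeff, fourierCoeffOn_eq_integral, fourierCoeffOn_eq_integral]
    simp
  have key := has_pointwise_sum_fourier_series_of_summable (f := G) (by rwa [hcoeff])
  rw [hcoeff] at key
  set θ' := toIocMod Real.two_pi_pos 0 θ with hθ'
  have hm : θ' ∈ Set.Ioc 0 (0 + 2 * Real.pi) := toIocMod_mem_Ioc _ _ _
  have hexp : exp (θ' * I) = exp (θ * I) := by
    have : θ' = θ - toIocDiv Real.two_pi_pos 0 θ • (2 * Real.pi) := rfl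
    rw [this, zsmul_eq_mul]
    push_cast
    rw [show ((θ - toIocDiv Real.two_pi_pos 0 θ * (2 * Real.pi)) * I : ℂ) =
      θ * I - (toIocDiv Real.two_pi_pos 0 θ : ℤ) * (2 * Real.pi * I) by ring]
    exact (Complex.exp_periodic.sub_int_mul_eq _)
  have h2 := key (θ' : AddCircle (2 * Real.pi))
  have h3 : G (θ' : AddCircle (2 * Real.pi)) = pullback β f θ :=
    (AddCircle.liftIoc_coe_apply hm).trans (pullback_congr_of_exp_eq β f hexp)
  rw [h3] at h2
  have e : ∀ j : ℤ, periodicCoeff (pullback β f) j • fourier j (θ' : AddCircle (2 * Real.pi)) =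
      periodicCoeff (pullback β f) j * exp (θ * I) ^ j := fun j => by
    have hpi : (Real.pi : ℂ) ≠ 0 := by exact_mod_cast Real.pi_ne_zero
    rw [fourier_coe_apply, ← hexp, ← Complex.exp_int_mul, smul_eq_mul]
    congr 2
    push_cast
    field_simp
  simp_rw [e] at h2
  exact h2

theorem hasSum_line {β : ℝ} (hβ : 0 < β) {f : ℝ → ℂ} (hc : Continuous f)
    (h0 : Tendsto f (cocompact ℝ) (𝓝 0)) (hs : Summable (periodicCoeff (pullback β f))) (x : ℝ) :
    HasSum (fun j : ℤ => periodicCoeff (pullback β f) j * moebius β x ^ j) (f x) := by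
  obtain ⟨θ, hθ⟩ := exists_exp_eq_moebius hβ x
  have := hasSum_pullback hβ hc h0 hs θ
  rwa [hθ, pullback_eq hβ f hθ] at this

/-! ### Aliasing -/

/-- The representative of `j` modulo `n` in `{-⌊(n-1)/2⌋, …, ⌊n/2⌋}`. -/
def aliasIndex (n : ℕ) (j : ℤ) : ℤ :=
  (j + ((n - 1) / 2 : ℕ)) % n - ((n - 1) / 2 : ℕ)

theorem aliasIndex_mem {n : ℕ} (hn : 1 ≤ n) (j : ℤ) :
    aliasIndex n j ∈ Finset.Icc (-(((n - 1) / 2 : ℕ) : ℤ)) ((n / 2 : ℕ) : ℤ) := by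
  have h1 := Int.emod_nonneg (j + ((n - 1) / 2 : ℕ)) (b := n) (by omega)
  have h2 := Int.emod_lt_of_pos (j + ((n - 1) / 2 : ℕ)) (b := n) (by omega)
  rw [Finset.mem_Icc, aliasIndex]
  omega

theorem dvd_sub_aliasIndex (n : ℕ) (j : ℤ) : (n : ℤ) ∣ j - aliasIndex n j := by
  have := Int.dvd_self_sub_emod (x := (j + ((n - 1) / 2 : ℕ))) (m := n)
  rw [aliasIndex]
  convert this using 1
  ring

theorem eq_aliasIndex_iff {n : ℕ} (hn : 1 ≤ n) {i : ℤ}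
    (hi : i ∈ Finset.Icc (-(((n - 1) / 2 : ℕ) : ℤ)) ((n / 2 : ℕ) : ℤ)) (j : ℤ) :
    i = aliasIndex n j ↔ (n : ℤ) ∣ j - i := by
  constructor
  · rintro rfl; exact dvd_sub_aliasIndex n j
  · intro h
    have h1 := aliasIndex_mem hn j
    have h2 := dvd_sub_aliasIndex n j
    rw [Finset.mem_Icc] at hi h1
    have h3 : (n : ℤ) ∣ i - aliasIndex n j := by
      have := dvd_sub h2 h
      rwa [sub_sub_sub_cancel_left] at this
    have h4 : |i - aliasIndex n j| < n := by
      rw [abs_lt]; omega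
    have := Int.eq_zero_of_abs_lt_dvd h3 h4
    omega

/-- Averages over the interpolation nodes detect divisibility by `n`. -/
theorem average_nodes {n : ℕ} (hn : 1 ≤ n) (m : ℤ) :
    (1 / n : ℂ) * ∑ l ∈ Finset.range n, exp ((2 * Real.pi * l / n : ℝ) * I) ^ m =
      if (n : ℤ) ∣ m then 1 else 0 := by
  have hn0 : n ≠ 0 := by omega
  have hnc : (n : ℂ) ≠ 0 := by exact_mod_cast hn0
  have hprim := Complex.isPrimitiveRoot_exp n hn0
  set ω := exp (2 * Real.pi * I / n) with hω
  have e : ∀ l : ℕ, exp ((2 * Real.pi * l / n : ℝ) * I) ^ m = (ω ^ m) ^ l := fun l => by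
    rw [← zpow_natCast, ← zpow_mul, mul_comm m, zpow_mul, zpow_natCast, hω, ← Complex.exp_nat_mul]
    congr 2; push_cast; ring
  simp_rw [e]
  split_ifs with h
  · have : ω ^ m = 1 := (hprim.zpow_eq_one_iff_dvd m).mpr h
    simp [this, hnc]
  · have h1 : ω ^ m ≠ 1 := fun h1 => h ((hprim.zpow_eq_one_iff_dvd m).mp h1)
    rw [geom_sum_eq h1, ← zpow_natCast, ← zpow_mul, mul_comm m, zpow_mul, zpow_natCast,
      hprim.pow_eq_one, one_zpow, sub_self, zero_div, mul_zero]

/-- Inserting the Fourier series at the nodes gives `F̃_i = ∑ a_j` over `j ≡ i` modulo `n`. Each `j`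
is congruent to exactly one `i` in the interpolation range, so regrouping replaces `M^j` by `M` to
the representative of `j`. -/
theorem hasSum_ratInterp {β : ℝ} (hβ : 0 < β) {f : ℝ → ℂ} (hc : Continuous f)
    (h0 : Tendsto f (cocompact ℝ) (𝓝 0)) (hs : Summable (periodicCoeff (pullback β f)))
    {n : ℕ} (hn : 1 ≤ n) (x : ℝ) :
    HasSum (fun j : ℤ => periodicCoeff (pullback β f) j * moebius β x ^ aliasIndex n j)
      (ratInterp β n f x) := by
  have h1 : ∀ i : ℤ, HasSum (fun j : ℤ => periodicCoeff (pullback β f) j *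
      if (n : ℤ) ∣ j - i then 1 else 0) (discreteCoeff n (pullback β f) i) := fun i => by
    have h2 := (hasSum_sum (s := Finset.range n) fun l _ =>
      (hasSum_pullback hβ hc h0 hs (2 * Real.pi * l / n)).mul_left
        (exp (-(I * i * (2 * Real.pi * l / n : ℝ))))).mul_left (1 / n : ℂ)
    have e : ∀ j : ℤ, (1 / n : ℂ) * ∑ l ∈ Finset.range n, exp (-(I * i * (2 * Real.pi * l / n : ℝ))) *
        (periodicCoeff (pullback β f) j * exp ((2 * Real.pi * l / n : ℝ) * I) ^ j) =
        periodicCoeff (pullback β f) j * if (n : ℤ) ∣ j - i then 1 else 0 := fun j => by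
      rw [← average_nodes hn, mul_left_comm (periodicCoeff _ _), Finset.mul_sum (s := Finset.range n)
        (a := periodicCoeff (pullback β f) j)]
      congr 1
      refine Finset.sum_congr rfl fun l _ => ?_
      rw [mul_left_comm, sub_eq_neg_add, zpow_add₀ (Complex.exp_ne_zero _),
        ← Complex.exp_int_mul _ (-i)]
      congr 3
      push_cast
      ring
    simp_rw [e] at h2
    exact h2
  have h3 := hasSum_sum (s := Finset.Icc (-(((n - 1) / 2 : ℕ) : ℤ)) ((n / 2 : ℕ) : ℤ))
    fun i _ => (h1 i).mul_right (moebius β x ^ i)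
  have e : ∀ j : ℤ, ∑ i ∈ Finset.Icc (-(((n - 1) / 2 : ℕ) : ℤ)) ((n / 2 : ℕ) : ℤ),
      (periodicCoeff (pullback β f) j * if (n : ℤ) ∣ j - i then 1 else 0) * moebius β x ^ i =
      periodicCoeff (pullback β f) j * moebius β x ^ aliasIndex n j := fun j => by
    rw [Finset.sum_eq_single_of_mem _ (aliasIndex_mem hn j)]
    · rw [if_pos (dvd_sub_aliasIndex n j), mul_one]
    · intro i hi hne
      rw [if_neg (fun h => hne ((eq_aliasIndex_iff hn hi j).mpr h))]
      simp
  simp_rw [e] at h3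
  exact h3


/-! ### Series in `L²` -/

/-- Fatou's lemma along an exhaustion by finite sets containing `S`; on each of them the triangle
inequality bounds the difference by the tail of `τ`. -/
theorem eLpNorm_sum_sub_hasSum_le {T : ℤ → ℝ → ℂ} (hT : ∀ j, AEStronglyMeasurable (T j))
    {τ : ℤ → ℝ} (hτ0 : ∀ j, 0 ≤ τ j) (hτ : Summable τ)
    (hle : ∀ j, eLpNorm (T j) 2 volume ≤ ENNReal.ofReal (τ j)) {g : ℝ → ℂ}
    (hg : ∀ x, HasSum (fun j => T j x) (g x)) (S : Finset ℤ) :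
    eLpNorm (fun x => (∑ j ∈ S, T j x) - g x) 2 volume ≤
      ENNReal.ofReal (∑' j, τ j - ∑ j ∈ S, τ j) := by
  let U : ℕ → Finset ℤ := fun N => S ∪ Finset.Icc (-(N : ℤ)) N
  have hU : Tendsto U atTop atTop := by
    refine tendsto_atTop_finset_of_monotone (fun a b hab => ?_) fun j => ⟨j.natAbs, ?_⟩
    · refine Finset.union_subset_union subset_rfl (Finset.Icc_subset_Icc ?_ ?_) <;> omega
    · refine Finset.mem_union_right _ (Finset.mem_Icc.mpr ⟨?_, ?_⟩) <;> omega
  have hsub : ∀ N, S ⊆ U N := fun N => Finset.subset_union_left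
  refine (Lp.eLpNorm_lim_le_liminf_eLpNorm
    (f := fun N x => (∑ j ∈ S, T j x) - ∑ j ∈ U N, T j x) (fun N => ?_) _
    (ae_of_all _ fun x => tendsto_const_nhds.sub ((hg x).comp hU))).trans ?_
  · exact (Finset.aestronglyMeasurable_fun_sum _ fun j _ => hT j).sub
      (Finset.aestronglyMeasurable_fun_sum _ fun j _ => hT j)
  · have hb : ∀ N, eLpNorm (fun x => (∑ j ∈ S, T j x) - ∑ j ∈ U N, T j x) 2 volume ≤
        ENNReal.ofReal (∑' j, τ j - ∑ j ∈ S, τ j) := fun N => by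
      have e : (fun x => (∑ j ∈ S, T j x) - ∑ j ∈ U N, T j x) =
          -∑ j ∈ U N \ S, T j := by
        ext x
        rw [← Finset.sum_sdiff (hsub N)]
        simp [Finset.sum_apply]
      rw [e, eLpNorm_neg]
      refine (eLpNorm_sum_le (fun j _ => hT j) one_le_two).trans ?_
      refine (Finset.sum_le_sum fun j _ => hle j).trans ?_
      rw [← ENNReal.ofReal_sum_of_nonneg fun j _ => hτ0 j]
      refine ENNReal.ofReal_le_ofReal ?_
      have h1 := Finset.sum_sdiff (f := τ) (hsub N)
      have h2 := hτ.sum_le_tsum (U N) fun j _ => hτ0 j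
      linarith
    refine (liminf_le_liminf (Eventually.of_forall hb)).trans ?_
    simp

/-! ### Estimates of weighted coefficients -/

theorem summable_one_add_abs_rpow {b : ℝ} (hb : 1 < b) :
    Summable fun j : ℤ => (1 + |(j : ℝ)|) ^ (-b) := by
  refine Summable.of_norm_bounded_eventually (Real.summable_abs_int_rpow hb) ?_
  filter_upwards [(Set.finite_singleton (0 : ℤ)).compl_mem_cofinite] with j hj
  have hj0 : (0 : ℝ) < |(j : ℝ)| := abs_pos.mpr (by exact_mod_cast hj)
  rw [Real.norm_of_nonneg (by positivity)]
  exact Real.rpow_le_rpow_of_nonpos hj0 (by linarith) (by linarith)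

/-- The squared norm `∑ (1 + |j|)^{2s} |a_j|²`. -/
def weightedSum (s : ℝ) (a : ℤ → ℂ) : ℝ := ∑' j : ℤ, (1 + |(j : ℝ)|) ^ (2 * s) * ‖a j‖ ^ 2

theorem weightedSum_nonneg (s : ℝ) (a : ℤ → ℂ) : 0 ≤ weightedSum s a :=
  tsum_nonneg fun _ => by positivity

theorem summable_weight_of_memPeriodicSobolev {s : ℝ} {F : ℝ → ℂ} (hF : MemPeriodicSobolev s F) :
    Summable fun j : ℤ => (1 + |(j : ℝ)|) ^ (2 * s) * ‖periodicCoeff F j‖ ^ 2 := by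
  have h1 : ∑' j : ℤ, ENNReal.ofReal ((1 + |(j : ℝ)|) ^ (2 * s) * ‖periodicCoeff F j‖ ^ 2) ≠ ∞ := by
    intro h
    have := hF.2
    rw [periodicSobolevNorm, h] at this
    simp at this
  refine (ENNReal.summable_toReal h1).congr fun j => ?_
  rw [ENNReal.toReal_ofReal (by positivity)]

theorem periodicSobolevNorm_eq {s : ℝ} {F : ℝ → ℂ} (hF : MemPeriodicSobolev s F) :
    periodicSobolevNorm s F = ENNReal.ofReal √(weightedSum s (periodicCoeff F)) := by
  rw [periodicSobolevNorm, ← ENNReal.ofReal_tsum_of_nonneg (fun j => by positivity)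
    (summable_weight_of_memPeriodicSobolev hF), Real.sqrt_eq_rpow,
    ← ENNReal.ofReal_rpow_of_nonneg (weightedSum_nonneg _ _) (by norm_num), weightedSum]

section

variable {s : ℝ} {a : ℤ → ℂ}
  (ha : Summable fun j : ℤ => (1 + |(j : ℝ)|) ^ (2 * s) * ‖a j‖ ^ 2)
include ha

theorem sum_weight_le (S : Finset ℤ) :
    ∑ j ∈ S, (1 + |(j : ℝ)|) ^ (2 * s) * ‖a j‖ ^ 2 ≤ weightedSum s a :=
  ha.sum_le_tsum S fun _ _ => by positivity

/-- Cauchy–Schwarz after inserting `(1 + |j|)^{-s} (1 + |j|)^s`. The exponent `1 + 2ε` makes the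
first sum converge; `D` records whatever decay in `n` is available on `S`. -/
theorem sum_mul_norm_le {ε : ℝ} (hε : 0 < ε) {d : ℤ → ℝ} {D : ℝ} (hD : 0 ≤ D) (S : Finset ℤ)
    (hd : ∀ j ∈ S, d j ^ 2 ≤ D * (1 + |(j : ℝ)|) ^ (-(1 + 2 * ε)) * (1 + |(j : ℝ)|) ^ (2 * s)) :
    ∑ j ∈ S, d j * ‖a j‖ ≤
      √(D * ∑' j : ℤ, (1 + |(j : ℝ)|) ^ (-(1 + 2 * ε))) * √(weightedSum s a) := by
  have hpos : ∀ j : ℤ, (0 : ℝ) < 1 + |(j : ℝ)| := fun j => by positivity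
  have e : ∀ j ∈ S, d j * ‖a j‖ =
      (d j * (1 + |(j : ℝ)|) ^ (-s)) * ((1 + |(j : ℝ)|) ^ s * ‖a j‖) := fun j _ => by
    rw [mul_assoc, ← mul_assoc _ _ ‖a j‖, ← Real.rpow_add (hpos j)]; simp
  have hsq : ∀ (j : ℤ) (t : ℝ), ((1 + |(j : ℝ)|) ^ t) ^ 2 = (1 + |(j : ℝ)|) ^ (2 * t) := fun j t => by
    rw [← Real.rpow_natCast, ← Real.rpow_mul (hpos j).le]; congr 1; push_cast; ring
  rw [Finset.sum_congr rfl e]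
  refine (Real.sum_mul_le_sqrt_mul_sqrt S _ _).trans ?_
  refine mul_le_mul (Real.sqrt_le_sqrt ?_) (Real.sqrt_le_sqrt ?_) (Real.sqrt_nonneg _)
    (Real.sqrt_nonneg _)
  · have hsum := summable_one_add_abs_rpow (b := 1 + 2 * ε) (by linarith)
    refine le_trans (Finset.sum_le_sum fun j hj => ?_)
      (le_trans (Finset.mul_sum S _ D).symm.le (mul_le_mul_of_nonneg_left
        (hsum.sum_le_tsum S fun j _ => (Real.rpow_pos_of_pos (hpos j) _).le) hD))
    rw [mul_pow, hsq]
    calc _ ≤ (D * (1 + |(j : ℝ)|) ^ (-(1 + 2 * ε)) * (1 + |(j : ℝ)|) ^ (2 * s)) *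
          (1 + |(j : ℝ)|) ^ (2 * -s) := by gcongr; exact hd j hj
      _ = D * (1 + |(j : ℝ)|) ^ (-(1 + 2 * ε)) := by
          rw [mul_assoc, ← Real.rpow_add (hpos j)]; simp
  · refine le_trans (Finset.sum_le_sum fun j _ => ?_) (sum_weight_le ha S)
    rw [mul_pow, hsq]

theorem summable_of_summable_weight {ε : ℝ} (hε : 0 < ε) (hs : 1 + ε < s) : Summable a := by
  refine Summable.of_norm (summable_of_sum_le
    (c := √(1 * ∑' j : ℤ, (1 + |(j : ℝ)|) ^ (-(1 + 2 * ε))) * √(weightedSum s a))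
    (fun _ => norm_nonneg _) fun S => ?_)
  have := sum_mul_norm_le ha hε (d := fun _ => 1) zero_le_one S fun j _ => ?_
  · simpa using this
  · have hpos : (0 : ℝ) < 1 + |(j : ℝ)| := by positivity
    rw [one_pow, one_mul, ← Real.rpow_add hpos]
    exact Real.one_le_rpow (by linarith [abs_nonneg (j : ℝ)]) (by linarith)

omit ha in
theorem rpow_one_add_abs_le {n : ℕ} (hn : 1 ≤ n) {j : ℤ} (hj : (n : ℤ) ≤ 2 * |j|) {t : ℝ}
    (ht : t ≤ 0) : (1 + |(j : ℝ)|) ^ t ≤ ((n : ℝ) / 2) ^ t := by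
  have hn0 : (0 : ℝ) < n := by exact_mod_cast hn
  have hj' : (n : ℝ) ≤ 2 * |(j : ℝ)| := by exact_mod_cast hj
  exact Real.rpow_le_rpow_of_nonpos (by positivity) (by linarith) ht

theorem sum_sqrt_mul_norm_le {ε : ℝ} (hε : 0 < ε) (hs : 1 + ε < s) {n : ℕ} (hn : 1 ≤ n)
    (S : Finset ℤ) (hS : ∀ j ∈ S, (n : ℤ) ≤ 2 * |j|) :
    ∑ j ∈ S, √|(j : ℝ)| * ‖a j‖ ≤
      √(∑' j : ℤ, (1 + |(j : ℝ)|) ^ (-(1 + 2 * ε))) * ((n : ℝ) / 2) ^ (1 + ε - s) *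
        √(weightedSum s a) := by
  have hn0 : (0 : ℝ) < n := by exact_mod_cast hn
  -- This `D` comes from `|j| ≤ (1 + |j|)^{2(1+ε-s) - (1+2ε) + 2s}`, the exponent being `1`; the
  -- first power is negative, so it may be evaluated at `n/2`.
  have h1 := sum_mul_norm_le ha hε (d := fun j => √|(j : ℝ)|)
    (D := ((n : ℝ) / 2) ^ (2 * (1 + ε - s))) (by positivity) S fun j hj => ?_
  · refine h1.trans (le_of_eq ?_)
    rw [Real.sqrt_mul (by positivity), two_mul, Real.rpow_add (by positivity),
      Real.sqrt_mul_self (by positivity)]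
    ring
  · have hpos : (0 : ℝ) < 1 + |(j : ℝ)| := by positivity
    rw [Real.sq_sqrt (abs_nonneg _)]
    calc |(j : ℝ)| ≤ (1 + |(j : ℝ)|) ^ (2 * (1 + ε - s)) * (1 + |(j : ℝ)|) ^ (-(1 + 2 * ε)) *
          (1 + |(j : ℝ)|) ^ (2 * s) := by
          rw [← Real.rpow_add hpos, ← Real.rpow_add hpos]
          ring_nf
          simp
      _ ≤ _ := by
          gcongr ?_ * _ * _
          exact rpow_one_add_abs_le hn (hS j hj) (by linarith)

theorem sum_index_mul_sq_le (hs : 1 < s) {n : ℕ} (hn : 1 ≤ n)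
    (S : Finset ℤ) (hS : ∀ j ∈ S, (n : ℤ) ≤ 2 * |j|) :
    ∑ j ∈ S, ‖(j : ℂ) * a j‖ ^ 2 ≤ ((n : ℝ) / 2) ^ (2 * (1 - s)) * weightedSum s a := by
  refine le_trans (Finset.sum_le_sum fun j hj => ?_) (le_trans (Finset.mul_sum S _ _).symm.le
    (mul_le_mul_of_nonneg_left (sum_weight_le ha S) (by positivity)))
  have hpos : (0 : ℝ) < 1 + |(j : ℝ)| := by positivity
  rw [norm_mul, mul_pow, Complex.norm_intCast, ← mul_assoc]
  gcongr
  calc |(j : ℝ)| ^ 2 ≤ (1 + |(j : ℝ)|) ^ 2 := by gcongr; linarith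
    _ = (1 + |(j : ℝ)|) ^ (2 * (1 - s)) * (1 + |(j : ℝ)|) ^ (2 * s) := by
      rw [← Real.rpow_add hpos, ← Real.rpow_natCast]; congr 1; push_cast; ring
    _ ≤ _ := by
      gcongr ?_ * _
      exact rpow_one_add_abs_le hn (hS j hj) (by linarith)

omit ha in
-- Writing `j = i + nm` with `m ≠ 0` and `|i| ≤ n/2` gives `1 + |j| ≥ n|m| - n/2 ≥ (n/2)|m|`. Since
-- `2s > 2`, the sum over `m` is bounded by that of `|m|^{-2}`; its term at `m = 0` is zero by the
-- convention for real powers.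
theorem sum_fiber_rpow_le (hs : 1 < s) {n : ℕ} (hn : 1 ≤ n) {i : ℤ} (hi : 2 * |i| ≤ n)
    (S : Finset ℤ) (hS : ∀ j ∈ S, (n : ℤ) ∣ j - i ∧ j ≠ i) :
    ∑ j ∈ S, (1 + |(j : ℝ)|) ^ (-(2 * s)) ≤
      ((n : ℝ) / 2) ^ (-(2 * s)) * ∑' m : ℤ, |(m : ℝ)| ^ (-2 : ℝ) := by
  have hn0 : (0 : ℝ) < n := by exact_mod_cast hn
  have hsum : Summable fun m : ℤ => |(m : ℝ)| ^ (-2 : ℝ) := Real.summable_abs_int_rpow one_lt_two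
  have hinj : Set.InjOn (fun j : ℤ => (j - i) / n) S := fun j hj l hl h => by
    have h1 := Int.ediv_mul_cancel (hS j hj).1
    have h2 := Int.ediv_mul_cancel (hS l hl).1
    simp only at h
    rw [h, h2] at h1
    omega
  calc _ ≤ ∑ j ∈ S, ((n : ℝ) / 2) ^ (-(2 * s)) * |(((j - i) / n : ℤ) : ℝ)| ^ (-2 : ℝ) := by
        refine Finset.sum_le_sum fun j hj => ?_
        obtain ⟨⟨m, hm⟩, hne⟩ := hS j hj
        have hm0 : m ≠ 0 := by rintro rfl; apply hne; linarith
        have hdiv : (j - i) / n = m := by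
          rw [hm]; exact Int.mul_ediv_cancel_left _ (by omega)
        rw [hdiv]
        have hm1 : (1 : ℝ) ≤ |(m : ℝ)| := by exact_mod_cast Int.one_le_abs hm0
        have hj' : (n : ℝ) / 2 * |(m : ℝ)| ≤ 1 + |(j : ℝ)| := by
          have h1 : (n : ℝ) * |(m : ℝ)| = |(j : ℝ) - i| := by
            have : ((j - i : ℤ) : ℝ) = n * m := by exact_mod_cast congrArg (Int.cast (R := ℝ)) hm
            rw [Int.cast_sub] at this
            rw [this, abs_mul, Nat.abs_cast]
          have h2 : |(j : ℝ) - i| ≤ |(j : ℝ)| + |(i : ℝ)| := abs_sub _ _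
          have h3 : 2 * |(i : ℝ)| ≤ n := by exact_mod_cast hi
          nlinarith
        calc (1 + |(j : ℝ)|) ^ (-(2 * s)) ≤ ((n : ℝ) / 2 * |(m : ℝ)|) ^ (-(2 * s)) :=
              Real.rpow_le_rpow_of_nonpos (by positivity) hj' (by linarith)
          _ = ((n : ℝ) / 2) ^ (-(2 * s)) * |(m : ℝ)| ^ (-(2 * s)) :=
              Real.mul_rpow (by positivity) (by positivity)
          _ ≤ _ := by
              gcongr ?_ * ?_
              exact Real.rpow_le_rpow_of_exponent_le hm1 (by linarith)
    _ = ((n : ℝ) / 2) ^ (-(2 * s)) *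
          ∑ m ∈ S.image (fun j : ℤ => (j - i) / n), |(m : ℝ)| ^ (-2 : ℝ) := by
        rw [← Finset.mul_sum, Finset.sum_image hinj]
    _ ≤ _ := by
        gcongr
        exact hsum.sum_le_tsum _ fun _ _ => by positivity

/-- Cauchy–Schwarz within each residue class, with `|i| ≤ n/2` for the factor `i`. The classes are
disjoint, so the weighted sums add up to at most the full squared norm. -/
theorem sum_aliased_sq_le (hs : 1 < s) {n : ℕ} (hn : 1 ≤ n)
    (S : Finset ℤ) (hS : ∀ j ∈ S, aliasIndex n j ≠ j) :
    ∑ i ∈ Finset.Icc (-(((n - 1) / 2 : ℕ) : ℤ)) ((n / 2 : ℕ) : ℤ),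
        ‖(i : ℂ) * ∑ j ∈ S with aliasIndex n j = i, a j‖ ^ 2 ≤
      ((n : ℝ) / 2) ^ (2 * (1 - s)) * (∑' m : ℤ, |(m : ℝ)| ^ (-2 : ℝ)) * weightedSum s a := by
  have hn0 : (0 : ℝ) < n := by exact_mod_cast hn
  set Z := ∑' m : ℤ, |(m : ℝ)| ^ (-2 : ℝ) with hZ
  have hZ0 : 0 ≤ Z := tsum_nonneg fun _ => by positivity
  set J := Finset.Icc (-(((n - 1) / 2 : ℕ) : ℤ)) ((n / 2 : ℕ) : ℤ) with hJ
  have hterm : ∀ i ∈ J, ‖(i : ℂ) * ∑ j ∈ S with aliasIndex n j = i, a j‖ ^ 2 ≤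
      ((n : ℝ) / 2) ^ (2 * (1 - s)) * Z *
        ∑ j ∈ S with aliasIndex n j = i, (1 + |(j : ℝ)|) ^ (2 * s) * ‖a j‖ ^ 2 := fun i hi => by
    have hi2 : 2 * |i| ≤ n := by
      rw [hJ, Finset.mem_Icc] at hi
      rcases abs_cases i with ⟨h, -⟩ | ⟨h, -⟩ <;> omega
    have hi3 : |(i : ℝ)| ≤ (n : ℝ) / 2 := by
      have : 2 * |(i : ℝ)| ≤ n := by exact_mod_cast hi2
      linarith
    have h1 := sum_fiber_rpow_le hs hn hi2 (S.filter fun j => aliasIndex n j = i) fun j hj => by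
      rw [Finset.mem_filter] at hj
      refine ⟨(eq_aliasIndex_iff hn hi j).mp hj.2.symm, fun h => hS j hj.1 ?_⟩
      rw [hj.2, h]
    have h2 : ‖∑ j ∈ S with aliasIndex n j = i, a j‖ ^ 2 ≤
        (∑ j ∈ S with aliasIndex n j = i, (1 + |(j : ℝ)|) ^ (-(2 * s))) *
        ∑ j ∈ S with aliasIndex n j = i, (1 + |(j : ℝ)|) ^ (2 * s) * ‖a j‖ ^ 2 := by
      refine (pow_le_pow_left₀ (norm_nonneg _) (norm_sum_le _ _) 2).trans ?_
      refine Finset.sum_sq_le_sum_mul_sum_of_sq_le_mul _ (fun j _ => by positivity)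
        (fun j _ => by positivity) fun j _ => ?_
      have hpos : (0 : ℝ) < 1 + |(j : ℝ)| := by positivity
      rw [← mul_assoc, ← Real.rpow_add hpos]
      simp
    rw [norm_mul, mul_pow, Complex.norm_intCast]
    have hw : 0 ≤ ∑ j ∈ S with aliasIndex n j = i, (1 + |(j : ℝ)|) ^ (2 * s) * ‖a j‖ ^ 2 :=
      Finset.sum_nonneg fun j _ => by positivity
    calc _ ≤ ((n : ℝ) / 2) ^ 2 * ((((n : ℝ) / 2) ^ (-(2 * s)) * Z) *
          ∑ j ∈ S with aliasIndex n j = i, (1 + |(j : ℝ)|) ^ (2 * s) * ‖a j‖ ^ 2) := by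
          gcongr
          exact h2.trans (mul_le_mul_of_nonneg_right h1 hw)
      _ = _ := by
          have : ((n : ℝ) / 2) ^ (2 * (1 - s)) = ((n : ℝ) / 2) ^ 2 * ((n : ℝ) / 2) ^ (-(2 * s)) := by
            rw [← Real.rpow_natCast, ← Real.rpow_add (by positivity)]; congr 1; push_cast; ring
          rw [this]; ring
  refine (Finset.sum_le_sum hterm).trans ?_
  rw [← Finset.mul_sum]
  gcongr
  rw [Finset.sum_fiberwise_of_maps_to fun j _ => aliasIndex_mem hn j]
  exact sum_weight_le ha S

end


/-! ### The interpolation error -/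

theorem le_two_mul_abs_of_aliasIndex_ne {n : ℕ} (hn : 1 ≤ n) {j : ℤ} (h : aliasIndex n j ≠ j) :
    (n : ℤ) ≤ 2 * |j| := by
  by_contra hlt
  refine h ((eq_aliasIndex_iff hn (Finset.mem_Icc.mpr ?_) j).mpr (by simp)).symm
  rcases abs_cases j with ⟨h1, h2⟩ | ⟨h1, h2⟩ <;> omega

theorem abs_aliasIndex_sub_le {n : ℕ} (hn : 1 ≤ n) {j : ℤ} (h : (n : ℤ) ≤ 2 * |j|) :
    |aliasIndex n j - j| ≤ 2 * |j| := by
  have := Finset.mem_Icc.mp (aliasIndex_mem hn j)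
  rcases abs_cases j with ⟨h1, -⟩ | ⟨h1, -⟩ <;>
    rcases abs_cases (aliasIndex n j - j) with ⟨h2, -⟩ | ⟨h2, -⟩ <;> omega

section

variable {β : ℝ} (hβ : 0 < β) {s : ℝ} {a : ℤ → ℂ}
  (ha : Summable fun j : ℤ => (1 + |(j : ℝ)|) ^ (2 * s) * ‖a j‖ ^ 2) {n : ℕ} (hn : 1 ≤ n)
include hβ hn

theorem eLpNorm_alias_term_le (a : ℤ → ℂ) (j : ℤ) :
    eLpNorm (fun x : ℝ => a j * (moebius β x ^ aliasIndex n j - moebius β x ^ j)) 2 volume ≤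
      ENNReal.ofReal (√(16 * Real.pi * β) *
        if (n : ℤ) ≤ 2 * |j| then √|(j : ℝ)| * ‖a j‖ else 0) := by
  by_cases hj : (n : ℤ) ≤ 2 * |j|
  · have e : (fun x : ℝ => a j * (moebius β x ^ aliasIndex n j - moebius β x ^ j)) =
        a j • fun x : ℝ => moebius β x ^ aliasIndex n j - moebius β x ^ j := rfl
    rw [if_pos hj, e, eLpNorm_const_smul]
    have h1 := eLpNorm_zpow_sub_zpow_le hβ (aliasIndex n j) j
    have h2 : √(8 * Real.pi * β * |((aliasIndex n j - j : ℤ) : ℝ)|) ≤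
        √(16 * Real.pi * β) * √|(j : ℝ)| := by
      rw [← Real.sqrt_mul (by positivity)]
      refine Real.sqrt_le_sqrt ?_
      -- The representative has modulus at most `n/2 ≤ |j|`; this doubles the constant `8πβ` to
      -- `16πβ`.
      have h3 : |((aliasIndex n j - j : ℤ) : ℝ)| ≤ 2 * |(j : ℝ)| := by
        exact_mod_cast abs_aliasIndex_sub_le hn hj
      calc _ ≤ 8 * Real.pi * β * (2 * |(j : ℝ)|) := by gcongr
        _ = _ := by ring
    calc _ ≤ ENNReal.ofReal ‖a j‖ * ENNReal.ofReal (√(16 * Real.pi * β) * √|(j : ℝ)|) := by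
          rw [ofReal_norm]
          gcongr
          exact h1.trans (ENNReal.ofReal_le_ofReal h2)
      _ = _ := by
          rw [← ENNReal.ofReal_mul (norm_nonneg _)]; congr 1; ring
  · have h1 : aliasIndex n j = j := not_not.mp fun h => hj (le_two_mul_abs_of_aliasIndex_ne hn h)
    simp [h1]

omit hβ in
include ha in
theorem sum_alias_bound_le {ε : ℝ} (hε : 0 < ε) (hs : 1 + ε < s) (S : Finset ℤ) :
    ∑ j ∈ S, √(16 * Real.pi * β) * (if (n : ℤ) ≤ 2 * |j| then √|(j : ℝ)| * ‖a j‖ else 0) ≤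
      √(16 * Real.pi * β) * (√(∑' j : ℤ, (1 + |(j : ℝ)|) ^ (-(1 + 2 * ε))) *
        ((n : ℝ) / 2) ^ (1 + ε - s) * √(weightedSum s a)) := by
  rw [← Finset.mul_sum, ← Finset.sum_filter]
  gcongr
  exact sum_sqrt_mul_norm_le ha hε hs hn _ fun j hj => (Finset.mem_filter.mp hj).2

include ha in
-- The triangle inequality term by term would cost `∑ |j||a_j|`, half a power of `n` too much.
-- Instead the aliased part `P` is collected by representative, the tail `Q` is kept as it is, and
-- Parseval applies to each.
theorem eLpNorm_alias_deriv_le (hs : 1 < s) (S : Finset ℤ) :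
    eLpNorm (fun x : ℝ => ∑ j ∈ S, a j *
      (I * (aliasIndex n j : ℤ) * moebiusDensity β x * moebius β x ^ aliasIndex n j -
        I * j * moebiusDensity β x * moebius β x ^ j)) 2 volume ≤
      ENNReal.ofReal (√(4 * Real.pi / β) * ((√(∑' m : ℤ, |(m : ℝ)| ^ (-2 : ℝ)) + 1) *
        ((n : ℝ) / 2) ^ (1 - s) * √(weightedSum s a))) := by
  have hn0 : (0 : ℝ) < n := by exact_mod_cast hn
  set Z := ∑' m : ℤ, |(m : ℝ)| ^ (-2 : ℝ) with hZ
  have hZ0 : 0 ≤ Z := tsum_nonneg fun _ => by positivity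
  set J := Finset.Icc (-(((n - 1) / 2 : ℕ) : ℤ)) ((n / 2 : ℕ) : ℤ) with hJ
  set S' := S.filter fun j => aliasIndex n j ≠ j with hS'
  have hS1 : ∀ j ∈ S', aliasIndex n j ≠ j := fun j hj => (Finset.mem_filter.mp hj).2
  have hS2 : ∀ j ∈ S', (n : ℤ) ≤ 2 * |j| := fun j hj =>
    le_two_mul_abs_of_aliasIndex_ne hn (hS1 j hj)
  have hsq : √(((n : ℝ) / 2) ^ (2 * (1 - s))) = ((n : ℝ) / 2) ^ (1 - s) := by
    rw [two_mul, Real.rpow_add (by positivity), Real.sqrt_mul_self (by positivity)]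
  let c : ℤ → ℂ := fun i => (i : ℂ) * ∑ j ∈ S' with aliasIndex n j = i, a j
  let P : ℝ → ℂ := fun x => (moebiusDensity β x : ℂ) * ∑ i ∈ J, c i * moebius β x ^ i
  let Q : ℝ → ℂ := fun x => (moebiusDensity β x : ℂ) * ∑ j ∈ S', ((j : ℂ) * a j) * moebius β x ^ j
  have hmeas : ∀ (t : Finset ℤ) (c : ℤ → ℂ), AEStronglyMeasurable (fun x : ℝ =>
      (moebiusDensity β x : ℂ) * ∑ i ∈ t, c i * moebius β x ^ i) := fun t c =>
    ((Complex.continuous_ofReal.comp (continuous_moebiusDensity hβ)).mul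
      (continuous_finsetSum _ fun i _ =>
        continuous_const.mul (continuous_moebius_zpow hβ i))).aestronglyMeasurable
  have e : (fun x : ℝ => ∑ j ∈ S, a j *
      (I * (aliasIndex n j : ℤ) * moebiusDensity β x * moebius β x ^ aliasIndex n j -
        I * j * moebiusDensity β x * moebius β x ^ j)) = I • (P - Q) := by
    ext x
    have h1 : ∑ j ∈ S, a j *
        (I * (aliasIndex n j : ℤ) * moebiusDensity β x * moebius β x ^ aliasIndex n j -
          I * j * moebiusDensity β x * moebius β x ^ j) = ∑ j ∈ S', a j *
        (I * (aliasIndex n j : ℤ) * moebiusDensity β x * moebius β x ^ aliasIndex n j -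
          I * j * moebiusDensity β x * moebius β x ^ j) := by
      refine (Finset.sum_filter_of_ne (p := fun j => aliasIndex n j ≠ j) fun j _ hne h =>
        hne ?_).symm
      rw [h, sub_self, mul_zero]
    have h2 : ∑ i ∈ J, c i * moebius β x ^ i =
        ∑ j ∈ S', (aliasIndex n j : ℂ) * a j * moebius β x ^ aliasIndex n j := by
      rw [← Finset.sum_fiberwise_of_maps_to (s := S') (t := J) (g := aliasIndex n)
        (fun j _ => aliasIndex_mem hn j)
        fun j => (aliasIndex n j : ℂ) * a j * moebius β x ^ aliasIndex n j]
      refine Finset.sum_congr rfl fun i _ => ?_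
      simp only [c, Finset.mul_sum, Finset.sum_mul]
      refine Finset.sum_congr rfl fun j hj => ?_
      rw [(Finset.mem_filter.mp hj).2]
    simp only [Pi.smul_apply, Pi.sub_apply, P, Q, smul_eq_mul]
    rw [h1, h2, ← mul_sub, ← Finset.sum_sub_distrib, Finset.mul_sum, Finset.mul_sum]
    refine Finset.sum_congr (Eq.refl S') fun j _ => ?_
    ring
  have hP : eLpNorm P 2 volume ≤ ENNReal.ofReal
      (√(4 * Real.pi / β) * (√Z * ((n : ℝ) / 2) ^ (1 - s) * √(weightedSum s a))) := by
    refine (eLpNorm_density_mul_sum_le hβ J c).trans (ENNReal.ofReal_le_ofReal ?_)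
    rw [Real.sqrt_mul (by positivity)]
    gcongr
    refine (Real.sqrt_le_sqrt (sum_aliased_sq_le ha hs hn S' hS1)).trans (le_of_eq ?_)
    rw [Real.sqrt_mul (by positivity), Real.sqrt_mul (by positivity), hsq]
    ring
  have hQ : eLpNorm Q 2 volume ≤ ENNReal.ofReal
      (√(4 * Real.pi / β) * (1 * ((n : ℝ) / 2) ^ (1 - s) * √(weightedSum s a))) := by
    refine (eLpNorm_density_mul_sum_le hβ S' _).trans (ENNReal.ofReal_le_ofReal ?_)
    rw [Real.sqrt_mul (by positivity)]
    gcongr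
    refine (Real.sqrt_le_sqrt (sum_index_mul_sq_le ha hs hn S' hS2)).trans (le_of_eq ?_)
    rw [Real.sqrt_mul (by positivity), hsq]
    ring
  have hI : ‖I‖ₑ = 1 := by rw [← ofReal_norm]; simp
  rw [e, eLpNorm_const_smul, hI, one_mul]
  refine (eLpNorm_sub_le (hmeas J c) (hmeas S' _) one_le_two).trans
    ((add_le_add hP hQ).trans (le_of_eq ?_))
  rw [← ENNReal.ofReal_add (by positivity) (by positivity)]
  congr 1
  ring

end

/-- Bounds for the interpolation error in `L²(ℝ)` and `H¹(ℝ)` in terms of the Fourier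
coefficients. -/
theorem exists_interpolation_bound {β : ℝ} (hβ : 0 < β) {ε s : ℝ} (hε : 0 < ε) (hs : 1 + ε < s) :
    ∃ C : ℝ, 0 < C ∧ ∀ a : ℤ → ℂ,
      (Summable fun j : ℤ => (1 + |(j : ℝ)|) ^ (2 * s) * ‖a j‖ ^ 2) → ∀ n : ℕ, 1 ≤ n →
      ∀ g : ℝ → ℂ, Continuous g →
      (∀ x : ℝ, HasSum (fun j => a j * (moebius β x ^ aliasIndex n j - moebius β x ^ j)) (g x)) →
      eLpNorm g 2 volume ≤
        ENNReal.ofReal (C * (n : ℝ) ^ (1 + ε - s) * √(weightedSum s a)) ∧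
      sobolevNorm 1 g ≤ ENNReal.ofReal (C * (n : ℝ) ^ (1 + ε - s) * √(weightedSum s a)) := by
  set K := ∑' j : ℤ, (1 + |(j : ℝ)|) ^ (-(1 + 2 * ε)) with hK
  set Z := ∑' m : ℤ, |(m : ℝ)| ^ (-2 : ℝ) with hZ
  have hZ0 : 0 ≤ Z := tsum_nonneg fun _ => by positivity
  -- The powers of `2⁻¹` in `C₁` and `C₂` turn `n/2` into `n`; the factor `2π` below comes from
  -- `sobolevNorm_one_le`.
  set C₁ : ℝ := √(16 * Real.pi * β) * √K * 2⁻¹ ^ (1 + ε - s) with hC₁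
  set C₂ : ℝ := √(4 * Real.pi / β) * (√Z + 1) * 2⁻¹ ^ (1 - s) with hC₂
  have hC₁0 : 0 ≤ C₁ := by positivity
  have hC₂0 : 0 < C₂ := by positivity
  refine ⟨2 * Real.pi * (C₁ + C₂), by positivity, fun a ha n hn g hgc hg => ?_⟩
  have hn0 : (0 : ℝ) < n := by exact_mod_cast hn
  have hn1 : (1 : ℝ) ≤ n := by exact_mod_cast hn
  set q := √(weightedSum s a) with hq
  set ν := (n : ℝ) ^ (1 + ε - s) with hν
  let T : ℤ → ℝ → ℂ := fun j x => a j * (moebius β x ^ aliasIndex n j - moebius β x ^ j)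
  let T' : ℤ → ℝ → ℂ := fun j x => a j *
      (I * (aliasIndex n j : ℤ) * moebiusDensity β x * moebius β x ^ aliasIndex n j -
        I * j * moebiusDensity β x * moebius β x ^ j)
  let τ : ℤ → ℝ := fun j => √(16 * Real.pi * β) *
    if (n : ℤ) ≤ 2 * |j| then √|(j : ℝ)| * ‖a j‖ else 0
  have hτ0 : ∀ j, 0 ≤ τ j := fun j => by
    refine mul_nonneg (Real.sqrt_nonneg _) ?_
    split_ifs <;> positivity
  have hB : ∀ S : Finset ℤ, ∑ j ∈ S, τ j ≤ C₁ * ν * q := fun S => by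
    refine (sum_alias_bound_le ha hn hε hs S).trans (le_of_eq ?_)
    rw [div_eq_mul_inv, Real.mul_rpow hn0.le (by norm_num)]
    ring
  have hB' : ∀ S : Finset ℤ, eLpNorm (fun x => ∑ j ∈ S, T' j x) 2 volume ≤
      ENNReal.ofReal (C₂ * ν * q) := fun S => by
    refine (eLpNorm_alias_deriv_le hβ ha hn (by linarith) S).trans (ENNReal.ofReal_le_ofReal ?_)
    rw [div_eq_mul_inv (n : ℝ), Real.mul_rpow hn0.le (by norm_num)]
    calc _ = C₂ * (n : ℝ) ^ (1 - s) * q := by ring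
      _ ≤ _ := by
        gcongr ?_ * ?_ * ?_
        exact Real.rpow_le_rpow_of_exponent_le hn1 (by linarith)
  have hτ : Summable τ := summable_of_sum_le hτ0 hB
  have hTle : ∀ j, eLpNorm (T j) 2 volume ≤ ENNReal.ofReal (τ j) := fun j =>
    eLpNorm_alias_term_le hβ hn a j
  have hTc : ∀ j, Continuous (T j) := fun j => continuous_const.mul
    ((continuous_moebius_zpow hβ _).sub (continuous_moebius_zpow hβ _))
  have hTm : ∀ j, AEStronglyMeasurable (T j) := fun j => (hTc j).aestronglyMeasurable
  have hgL : eLpNorm g 2 volume ≤ ENNReal.ofReal (C₁ * ν * q) := by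
    -- With the empty partial sum the tail estimate bounds `g` itself.
    have h1 := eLpNorm_sum_sub_hasSum_le hTm hτ0 hτ hTle hg ∅
    simp only [Finset.sum_empty, zero_sub, sub_zero] at h1
    refine (le_of_eq ?_).trans (h1.trans (ENNReal.ofReal_le_ofReal (hτ.tsum_le_of_sum_le hB)))
    exact (eLpNorm_neg g 2 volume).symm
  have hgm : MemLp g 2 volume := ⟨hgc.aestronglyMeasurable, hgL.trans_lt ENNReal.ofReal_lt_top⟩
  have hpi : 1 ≤ 2 * Real.pi := by linarith [Real.pi_gt_three]
  refine ⟨hgL.trans (ENNReal.ofReal_le_ofReal ?_), ?_⟩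
  · gcongr
    calc C₁ ≤ 1 * (C₁ + C₂) := by linarith
      _ ≤ _ := by gcongr
  · let U : ℕ → Finset ℤ := fun N => Finset.Icc (-(N : ℤ)) N
    have hU : Tendsto U atTop atTop := by
      refine tendsto_atTop_finset_of_monotone (fun a b hab => ?_) fun j => ⟨j.natAbs, ?_⟩
      · refine Finset.Icc_subset_Icc ?_ ?_ <;> omega
      · refine Finset.mem_Icc.mpr ⟨?_, ?_⟩ <;> omega
    have hUL : ∀ N, eLpNorm (fun x => ∑ j ∈ U N, T j x) 2 volume ≤ ENNReal.ofReal (C₁ * ν * q) :=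
      fun N => by
        have e : (fun x => ∑ j ∈ U N, T j x) = ∑ j ∈ U N, T j := by ext x; simp
        rw [e]
        refine (eLpNorm_sum_le (fun j _ => hTm j) one_le_two).trans ?_
        refine (Finset.sum_le_sum fun j _ => hTle j).trans ?_
        rw [← ENNReal.ofReal_sum_of_nonneg fun j _ => hτ0 j]
        exact ENNReal.ofReal_le_ofReal (hB _)
    have hUm : ∀ N, MemLp (fun x => ∑ j ∈ U N, T j x) 2 volume := fun N =>
      ⟨(continuous_finsetSum _ fun j _ => hTc j).aestronglyMeasurable,
        (hUL N).trans_lt ENNReal.ofReal_lt_top⟩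
    have hρ : Continuous fun x : ℝ => (moebiusDensity β x : ℂ) :=
      Complex.continuous_ofReal.comp (continuous_moebiusDensity hβ)
    have hUm' : ∀ N, MemLp (fun x => ∑ j ∈ U N, T' j x) 2 volume := fun N =>
      ⟨(continuous_finsetSum _ fun j _ => continuous_const.mul
        (((continuous_const.mul hρ).mul (continuous_moebius_zpow hβ _)).sub
        ((continuous_const.mul hρ).mul (continuous_moebius_zpow hβ _)))).aestronglyMeasurable,
        (hB' _).trans_lt ENNReal.ofReal_lt_top⟩
    -- Only the finite partial sums are differentiated; differentiability of `g` is never needed.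
    refine sobolevNorm_one_le_of_tendsto hgm hUm ?_ fun N => ?_
    · have h1 : Tendsto (fun N => ENNReal.ofReal (∑' j, τ j - ∑ j ∈ U N, τ j)) atTop (𝓝 0) := by
        have h2 : Tendsto (fun N => ∑' j, τ j - ∑ j ∈ U N, τ j) atTop
            (𝓝 (∑' j, τ j - ∑' j, τ j)) := tendsto_const_nhds.sub (hτ.hasSum.comp hU)
        rw [sub_self] at h2
        simpa using ENNReal.tendsto_ofReal h2
      exact tendsto_of_tendsto_of_tendsto_of_le_of_le tendsto_const_nhds h1 (fun _ => zero_le)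
        fun N => eLpNorm_sum_sub_hasSum_le hTm hτ0 hτ hTle hg (U N)
    · have hd : ∀ x, HasDerivAt (fun x => ∑ j ∈ U N, T j x) (∑ j ∈ U N, T' j x) x := fun x =>
        HasDerivAt.fun_sum fun j _ => ((hasDerivAt_moebius_zpow hβ _ x).sub
          (hasDerivAt_moebius_zpow hβ _ x)).const_mul _
      refine (sobolevNorm_one_le (hUm N) (hUm' N) hd).trans ?_
      calc _ ≤ ENNReal.ofReal (2 * Real.pi) *
            (ENNReal.ofReal (C₁ * ν * q) + ENNReal.ofReal (C₂ * ν * q)) := by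
            gcongr
            · exact hUL N
            · exact hB' _
        _ = _ := by
            rw [← ENNReal.ofReal_add (by positivity) (by positivity),
              ← ENNReal.ofReal_mul (by positivity)]
            congr 1
            ring


theorem continuous_ratInterp {β : ℝ} (hβ : 0 < β) (n : ℕ) (f : ℝ → ℂ) :
    Continuous (ratInterp β n f) :=
  continuous_finsetSum _ fun i _ => continuous_const.mul (continuous_moebius_zpow hβ i)

/-- Membership of the interpolant in `H¹(ℝ)` is obtained from the error bound, since the separate
powers of `M` in it are not square integrable. -/
theorem MemSobolevLine.of_sub {f R : ℝ → ℂ} (hf : MemSobolevLine 1 f)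
    (hg : MemSobolevLine 1 fun x => R x - f x) : MemSobolevLine 1 R := by
  have hR : MemLp R 2 volume := by
    have := hg.1.add hf.1
    refine this.ae_eq (ae_of_all _ fun x => ?_)
    simp
  refine ⟨hR, ?_⟩
  have h1 : sobolevWeight (fourierL2 R hR) =ᵐ[volume]
      sobolevWeight (fourierL2 _ hg.1) + sobolevWeight (fourierL2 f hf.1) := by
    have h2 : fourierL2 R hR =ᵐ[volume] fun t => fourierL2 _ hg.1 t + fourierL2 f hf.1 t := by
      filter_upwards [fourierL2_sub hR hf.1 hg.1] with t ht
      rw [ht]; ring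
    refine (sobolevWeight_congr h2).trans (ae_of_all _ fun ξ => ?_)
    simp only [sobolevWeight, Pi.add_apply]; ring
  rw [sobolevNorm_one_eq R hR, eLpNorm_congr_ae h1]
  exact (eLpNorm_add_le (aestronglyMeasurable_sobolevWeight (memLp_fourierL2 _ _).1)
    (aestronglyMeasurable_sobolevWeight (memLp_fourierL2 _ _).1) one_le_two).trans_lt
    (ENNReal.add_lt_top.mpr ⟨hg.memLp_weight, hf.memLp_weight⟩)

/-- Rate of convergence of the rational interpolants in `L²(ℝ)` and `H¹(ℝ)`. -/
theorem exists_ratInterp_bound {β : ℝ} (hβ : 0 < β) {ε s : ℝ} (hε : 0 < ε) (hs : 1 + ε < s) :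
    ∃ C : ℝ, 0 < C ∧ ∀ f : ℝ → ℂ, Continuous f → MemSobolevLine 1 f →
      MemPeriodicSobolev s (pullback β f) → ∀ n : ℕ, 1 ≤ n →
      eLpNorm (fun x => ratInterp β n f x - f x) 2 volume ≤
        ENNReal.ofReal (C * (n : ℝ) ^ (1 + ε - s)) * periodicSobolevNorm s (pullback β f) ∧
      sobolevNorm 1 (fun x => ratInterp β n f x - f x) ≤
        ENNReal.ofReal (C * (n : ℝ) ^ (1 + ε - s)) * periodicSobolevNorm s (pullback β f) := by
  obtain ⟨C, hC, h⟩ := exists_interpolation_bound hβ hε hs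
  refine ⟨C, hC, fun f hc hf hF n hn => ?_⟩
  have ha := summable_weight_of_memPeriodicSobolev hF
  have hsum := summable_of_summable_weight ha hε hs
  have h0 := hf.tendsto_cocompact hc
  have := h _ ha n hn (fun x => ratInterp β n f x - f x) ((continuous_ratInterp hβ n f).sub hc)
    fun x => by
      simp_rw [mul_sub]
      exact (hasSum_ratInterp hβ hc h0 hsum hn x).sub (hasSum_line hβ hc h0 hsum x)
  rwa [ENNReal.ofReal_mul (by positivity), ← periodicSobolevNorm_eq hF] at this

end OscCauchy

end

/-! ### The theorem on oscillatory Cauchy integrals -/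

open MeasureTheory Filter Topology OscCauchy
theorem mainTheorem4 (β : ℝ) (hβ : 0 < β) (ε s : ℝ) (hε : 0 < ε) (hs : 1 + ε < s) :
    ∃ C : ℝ, 0 < C ∧ ∀ f : ℝ → ℂ, Continuous f → MemSobolevLine 1 f →
      MemPeriodicSobolev s (pullback β f) → ∀ k : ℝ,
      -- the Cauchy integrals converge and have boundary values
      ((∀ z : ℂ, z.im ≠ 0 → Integrable (cauchyIntegrand k f z)) ∧
        (∀ n : ℕ, 1 ≤ n → ∀ z : ℂ, z.im ≠ 0 →
          Integrable (cauchyIntegrand k (ratInterp β n f) z)) ∧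
        (∀ (σ : ℤˣ) (x : ℝ),
          Tendsto (fun η : ℝ => oscCauchy k f (x + ((σ : ℤ) : ℂ) * η * Complex.I))
            (𝓝[>] 0) (𝓝 (boundaryValue σ (oscCauchy k f) x))) ∧
        (∀ n : ℕ, 1 ≤ n → ∀ (σ : ℤˣ) (x : ℝ),
          Tendsto (fun η : ℝ => oscCauchyApprox β k n f (x + ((σ : ℤ) : ℂ) * η * Complex.I))
            (𝓝[>] 0) (𝓝 (boundaryValue σ (oscCauchyApprox β k n f) x)))) ∧
      -- the error bounds, uniform in `δ ≥ 0`
      (∀ n : ℕ, 1 ≤ n → ∀ (σ : ℤˣ) (δ : ℝ), 0 ≤ δ →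
        (sobolevNorm 1 (lineError β k n f σ δ) ≤
            ENNReal.ofReal (1 + |k|) * sobolevNorm 1 (fun x => ratInterp β n f x - f x) ∧
          ENNReal.ofReal (1 + |k|) * sobolevNorm 1 (fun x => ratInterp β n f x - f x) ≤
            ENNReal.ofReal (C * (1 + |k|) * (n : ℝ) ^ (1 + ε - s)) *
              periodicSobolevNorm s (pullback β f)) ∧
        (eLpNorm (lineError β k n f σ δ) 2 volume ≤
            eLpNorm (fun x => ratInterp β n f x - f x) 2 volume ∧
          eLpNorm (fun x => ratInterp β n f x - f x) 2 volume ≤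
            ENNReal.ofReal (C * (n : ℝ) ^ (1 + ε - s)) *
              periodicSobolevNorm s (pullback β f)) ∧
        ((⨆ x : ℝ, ‖lineError β k n f σ δ x‖ₑ) ≤ sobolevNorm 1 (lineError β k n f σ 0) ∧
          (⨆ x : ℝ, ‖lineError β k n f σ δ x‖ₑ) ≤
            ENNReal.ofReal (C * (1 + |k|) * (n : ℝ) ^ (1 + ε - s)) *
              periodicSobolevNorm s (pullback β f))) ∧
      -- for fixed `k`, uniform convergence in the whole plane
      TendstoUniformlyOn (fun (n : ℕ) (z : ℂ) => oscCauchyApprox β k n f z) (oscCauchy k f)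
          atTop {z : ℂ | z.im ≠ 0} ∧
      ∀ σ : ℤˣ, TendstoUniformly
        (fun (n : ℕ) (x : ℝ) => boundaryValue σ (oscCauchyApprox β k n f) x)
        (boundaryValue σ (oscCauchy k f)) atTop := by
  obtain ⟨C, hC, hbound⟩ := exists_ratInterp_bound hβ hε hs
  refine ⟨C, hC, fun f hc hf hF k => ?_⟩
  have hP : periodicSobolevNorm s (pullback β f) < ⊤ := hF.2
  have hg : ∀ n : ℕ, 1 ≤ n → MemSobolevLine 1 fun x => ratInterp β n f x - f x := fun n hn =>
    ⟨⟨((continuous_ratInterp hβ n f).sub hc).aestronglyMeasurable,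
      (hbound f hc hf hF n hn).1.trans_lt (ENNReal.mul_lt_top ENNReal.ofReal_lt_top hP)⟩,
      (hbound f hc hf hF n hn).2.trans_lt (ENNReal.mul_lt_top ENNReal.ofReal_lt_top hP)⟩
  have hR : ∀ n : ℕ, 1 ≤ n → MemSobolevLine 1 (ratInterp β n f) := fun n hn => hf.of_sub (hg n hn)
  have hk : 0 ≤ 1 + |k| := by positivity
  have hH : ∀ n : ℕ, 1 ≤ n →
      ENNReal.ofReal (1 + |k|) * sobolevNorm 1 (fun x => ratInterp β n f x - f x) ≤
        ENNReal.ofReal (C * (1 + |k|) * (n : ℝ) ^ (1 + ε - s)) *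
          periodicSobolevNorm s (pullback β f) := fun n hn => by
    rw [mul_comm C, mul_assoc, ENNReal.ofReal_mul hk, mul_assoc]
    gcongr
    exact (hbound f hc hf hF n hn).2
  have hE : ∀ n : ℕ, 1 ≤ n → ∀ (σ : ℤˣ) (δ : ℝ), 0 ≤ δ → _ := fun n hn σ δ hδ =>
    sobolevNorm_lineTrace_sub_le hf (hR n hn) (hg n hn).1 k σ hδ
  have hsup : ∀ n : ℕ, 1 ≤ n → ∀ (σ : ℤˣ) (δ : ℝ), 0 ≤ δ →
      (⨆ x : ℝ, ‖lineError β k n f σ δ x‖ₑ) ≤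
        ENNReal.ofReal (C * (1 + |k|) * (n : ℝ) ^ (1 + ε - s)) *
          periodicSobolevNorm s (pullback β f) := fun n hn σ δ hδ =>
    (hE n hn σ δ hδ).2.2.trans ((hE n hn σ 0 le_rfl).1.trans (hH n hn))
  have hlim : Tendsto (fun n : ℕ => ENNReal.ofReal (C * (1 + |k|) * (n : ℝ) ^ (1 + ε - s)) *
      periodicSobolevNorm s (pullback β f)) atTop (𝓝 0) := by
    have h1 : Tendsto (fun n : ℕ => C * (1 + |k|) * (n : ℝ) ^ (-(s - (1 + ε)))) atTop
        (𝓝 (C * (1 + |k|) * 0)) :=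
      ((tendsto_rpow_neg_atTop (by linarith)).comp tendsto_natCast_atTop_atTop).const_mul _
    have h2 := ENNReal.Tendsto.mul_const (b := periodicSobolevNorm s (pullback β f))
      (ENNReal.tendsto_ofReal h1) (Or.inr hP.ne)
    simpa using h2
  -- Uniformity in the sign and in `δ ≥ 0` together covers the whole of `ℂ \ ℝ` (with `δ = |Im z|`)
  -- and the boundary values (`δ = 0`).
  have hunif : ∀ r : ℝ, 0 < r → ∀ᶠ n : ℕ in atTop, ∀ (σ : ℤˣ) (δ : ℝ), 0 ≤ δ → ∀ x : ℝ,
      ‖lineError β k n f σ δ x‖ < r := fun r hr => by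
    filter_upwards [hlim.eventually_lt_const (ENNReal.ofReal_pos.mpr hr), eventually_ge_atTop 1]
      with n hn1 hn σ δ hδ x
    have := ((le_iSup (fun x : ℝ => ‖lineError β k n f σ δ x‖ₑ) x).trans
      (hsup n hn σ δ hδ)).trans_lt hn1
    rwa [← ofReal_norm, ENNReal.ofReal_lt_ofReal_iff hr] at this
  refine ⟨⟨fun z hz => integrable_cauchyIntegrand hf.1 k hz,
    fun n hn z hz => integrable_cauchyIntegrand (hR n hn).1 k hz, fun σ x => ?_,
    fun n hn σ x => ?_⟩, fun n hn σ δ hδ => ⟨⟨(hE n hn σ δ hδ).1, hH n hn⟩,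
    ⟨(hE n hn σ δ hδ).2.1, (hbound f hc hf hF n hn).1⟩, (hE n hn σ δ hδ).2.2, hsup n hn σ δ hδ⟩,
    ?_, fun σ => ?_⟩
  · rw [boundaryValue_oscCauchy hf]
    exact tendsto_oscCauchy hf k σ x
  · have := boundaryValue_oscCauchy (hR n hn) k σ x
    change Tendsto _ _ (𝓝 (boundaryValue σ (oscCauchy k (ratInterp β n f)) x))
    rw [this]
    exact tendsto_oscCauchy (hR n hn) k σ x
  · rw [Metric.tendstoUniformlyOn_iff]
    intro r hr
    filter_upwards [hunif r hr] with n hn z hz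
    have hz' : |z.im| ≠ 0 := abs_ne_zero.mpr hz
    -- The sign `σ` is that of `Im z`, which places `z` on the line `ℝ + iσ|Im z|`.
    obtain ⟨σ, hσ⟩ : ∃ σ : ℤˣ, z = z.re + ((σ : ℤ) : ℂ) * |z.im| * Complex.I := by
      rcases abs_cases z.im with ⟨h1, -⟩ | ⟨h1, -⟩
      · exact ⟨1, by simp [h1, Complex.re_add_im]⟩
      · exact ⟨-1, by simp [h1, Complex.re_add_im]⟩
    have := hn σ |z.im| (abs_nonneg _) z.re
    rw [lineError, lineTrace, lineTrace, if_neg hz', if_neg hz', ← hσ] at this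
    rwa [dist_eq_norm]
  · rw [Metric.tendstoUniformly_iff]
    intro r hr
    filter_upwards [hunif r hr] with n hn x
    have := hn σ 0 le_rfl x
    rw [lineError, lineTrace, lineTrace, if_pos rfl, if_pos rfl] at this
    rwa [dist_eq_norm]
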